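/- Let $0<p\le q$ be integers, $n=p+q$, $s=\operatorname{diag}(-I_p,I_q)$, and equip $\mathbb C^n$ with the form $\langle v,w\rangle=-\sum_{i=1}^p\overline{v_i}w_i+\sum_{i=p+1}^{n}\overline{v_i}w_i$. For $A\in\mathbb C^{n\times n}$ let $A^*=s\bar A^ts$ be its adjoint with respect to $\langle\cdot,\cdot\rangle$, and let $V^\perp$ denote the orthogonal complement of a subspace $V$ with respect to $\langle\cdot,\cdot\rangle$; $V$ is isotropic if $\langle\cdot,\cdot\rangle$ vanishes on $V$. Let $\mathcal L^-\mathrm U_{p,q}$ be the group of all invertible $n\times n$ matrices $g(\lambda)$ of complex rational functions in $\lambda$ with $g(\infty)=I$ and $(g(\bar\lambda)^*)^{-1}=g(\lambda)$. Consider the following loops. (1) $p_{\alpha,L}(\lambda)=\frac{\lambda-\alpha}{\lambda-\bar\alpha}\,\pi_L+\pi_{L^\perp}$, where $\alpha\in\mathbb C$, $L$ is a complex line with $\mathbb C^n=L\oplus L^\perp$, and $\pi_L,\pi_{L^\perp}$ are the projections of this decomposition. (2) $q_{\alpha,\beta,L}(\lambda)=\frac{\lambda-\alpha}{\lambda-\beta}\,\pi_L+\pi_{(L\oplus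 sL)^\perp}+\frac{\lambda-\bar\beta}{\lambda-\bar\alpha}\,\pi_{sL}$, where $\alpha,\beta\in\mathbb C$, $L$ is an isotropic complex line, and the projections are those of the decomposition $\mathbb C^n=L\oplus(L\oplus sL)^\perp\oplus sL$. (3) $m_{\alpha,k,N}(\lambda)=I+(\lambda-\alpha)^{-k}N$, where $\alpha\in\mathbb R$, $k\in\{1,2\}$, $N\in\mathbb C^{n\times n}$, $N^2=0$, $N^*=-N$ and $\operatorname{rank}N=1$. (4) $n_{\alpha,1,N}(\lambda)=I+(\lambda-\alpha)^{-1}N+\frac12(\lambda-\alpha)^{-2}N^2$, where $\alpha\in\mathbb R$, $N=M-M^*$, $M:(V\oplus sV)^\perp\to V$ is a linear map for some maximal isotropic subspace $V$, extended by zero on $V\oplus sV$ to $\mathbb C^n$, $\operatorname{rank}M=1$ and $\operatorname{rank}N=2$. If $p=q$, then all loops of types (1), (2), (3) belong to $\mathcal L^-\mathrm U_{p,q}$ and they generate this group. If $p\ne q$, then all loops of types (1), (2), (3), (4) belong to $\mathcal L^-\mathrm U_{p,q}$ and they generate this group. -/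

import Mathlib

/-! Rational loops with values in `GL n ℂ` and in `U(p,q)`, and the projective and nilpotent
simple elements. Loops are invertible matrices over the field `RatFunc ℂ` of rational functions in
one variable `λ` (written `RatFunc.X`). -/

namespace RationalLoop

open scoped Classical in
/-- The rational function `f` is holomorphic at `∞` with value `c` there: `f - c` vanishes at `∞`,
i.e. its valuation at infinity is less than one (it is `0`, or its numerator has smaller degree
than its denominator). -/
noncomputable def HasValueAtInfty (f : RatFunc ℂ) (c : ℂ) : Prop :=
  RatFunc.inftyValuation ℂ (f - RatFunc.C c) < 1

theorem hasValueAtInfty_iff (f : RatFunc ℂ) (c : ℂ) :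
    HasValueAtInfty f c ↔ f = RatFunc.C c ∨ (f - RatFunc.C c).intDegree < 0 := by
  classical
  unfold HasValueAtInfty
  rw [RatFunc.inftyValuation_apply, RatFunc.inftyValuationDef]
  split_ifs with h
  · simp [sub_eq_zero.mp h]
  · have h' : f ≠ RatFunc.C c := fun e => h (by simp [e])
    simp only [h', false_or]
    rw [← WithZero.exp_zero, WithZero.exp_lt_exp]

/-- `g(∞) = I`. -/
def NormalizedAtInfty {ι : Type*} [DecidableEq ι] (A : Matrix ι ι (RatFunc ℂ)) : Prop :=
  ∀ i j, HasValueAtInfty (A i j) ((1 : Matrix ι ι ℂ) i j)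

theorem C_one_apply {ι : Type*} [DecidableEq ι] (i j : ι) :
    RatFunc.C ((1 : Matrix ι ι ℂ) i j) = (1 : Matrix ι ι (RatFunc ℂ)) i j := by
  by_cases h : i = j <;> simp [Matrix.one_apply, h]

section

variable {ι : Type*} [DecidableEq ι]

theorem normalizedAtInfty_one : NormalizedAtInfty (1 : Matrix ι ι (RatFunc ℂ)) := by
  intro i j
  rw [HasValueAtInfty, C_one_apply]
  simp

open scoped Classical in
theorem valuation_le_one {A : Matrix ι ι (RatFunc ℂ)} (hA : NormalizedAtInfty A) (i j : ι) :
    RatFunc.inftyValuation ℂ (A i j) ≤ 1 := by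
  have h := hA i j
  rw [HasValueAtInfty, C_one_apply] at h
  have h1 : RatFunc.inftyValuation ℂ ((1 : Matrix ι ι (RatFunc ℂ)) i j) ≤ 1 := by
    by_cases hij : i = j <;> simp [Matrix.one_apply, hij]
  have := (RatFunc.inftyValuation ℂ).map_add (A i j - (1 : Matrix ι ι (RatFunc ℂ)) i j)
    ((1 : Matrix ι ι (RatFunc ℂ)) i j)
  rw [sub_add_cancel] at this
  exact this.trans (max_le h.le h1)

variable [Fintype ι]

open scoped Classical in
theorem valuation_sub_mul_lt {A B : Matrix ι ι (RatFunc ℂ)} (hA : NormalizedAtInfty A)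
    {c : WithZero (Multiplicative ℤ)} (hc : 0 < c)
    (hB : ∀ i j, RatFunc.inftyValuation ℂ (B i j) ≤ c) (i j : ι) :
    RatFunc.inftyValuation ℂ ((A * B) i j - B i j) < c := by
  have e : (A * B) i j - B i j = ((A - 1) * B) i j := by
    simp [sub_mul]
  rw [e, Matrix.mul_apply]
  refine (RatFunc.inftyValuation ℂ).map_sum_lt' hc fun k _ => ?_
  rw [map_mul]
  have h := hA i k
  rw [HasValueAtInfty, C_one_apply, ← Matrix.sub_apply] at h
  calc _ ≤ RatFunc.inftyValuation ℂ ((A - 1) i k) * c := by gcongr; exact hB k j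
    _ < 1 * c := by gcongr
    _ = c := one_mul c

theorem NormalizedAtInfty.mul {A B : Matrix ι ι (RatFunc ℂ)} (hA : NormalizedAtInfty A)
    (hB : NormalizedAtInfty B) : NormalizedAtInfty (A * B) := by
  classical
  intro i j
  have h1 := valuation_sub_mul_lt hA zero_lt_one (valuation_le_one hB) i j
  have h2 := hB i j
  rw [HasValueAtInfty] at h2 ⊢
  have := (RatFunc.inftyValuation ℂ).map_add_lt h1 h2
  rwa [sub_add_sub_cancel] at this

theorem NormalizedAtInfty.of_mul_eq_one {A B : Matrix ι ι (RatFunc ℂ)}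
    (hA : NormalizedAtInfty A) (hAB : A * B = 1) : NormalizedAtInfty B := by
  classical
  have key : ∀ i j, RatFunc.inftyValuation ℂ (B i j) ≤ 1 := by
    by_contra! hcon
    obtain ⟨i₀, j₀, h₀⟩ := hcon
    obtain ⟨x, -, hx⟩ := Finset.exists_max_image (Finset.univ : Finset (ι × ι))
      (fun x => RatFunc.inftyValuation ℂ (B x.1 x.2)) ⟨(i₀, j₀), Finset.mem_univ _⟩
    have hx1 : 1 < RatFunc.inftyValuation ℂ (B x.1 x.2) :=
      h₀.trans_le (hx (i₀, j₀) (Finset.mem_univ _))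
    have hlt := valuation_sub_mul_lt hA (zero_lt_one.trans hx1)
      (fun i j => hx (i, j) (Finset.mem_univ _)) x.1 x.2
    rw [hAB] at hlt
    have h1 : RatFunc.inftyValuation ℂ ((1 : Matrix ι ι (RatFunc ℂ)) x.1 x.2) ≤ 1 := by
      by_cases hij : x.1 = x.2 <;> simp [Matrix.one_apply, hij]
    have := (RatFunc.inftyValuation ℂ).map_sub_lt (h1.trans_lt hx1) hlt
    rw [sub_sub_cancel] at this
    exact lt_irrefl _ this
  intro i j
  have h := valuation_sub_mul_lt hA zero_lt_one key i j
  rw [hAB, Valuation.map_sub_swap] at h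
  rwa [HasValueAtInfty, C_one_apply]

end

/-- The full rational loop group: invertible matrices of rational functions with value the identity
matrix at `∞`. -/
def loopGL (ι : Type*) [Fintype ι] [DecidableEq ι] : Subgroup (GL ι (RatFunc ℂ)) where
  carrier := {g | NormalizedAtInfty (g : Matrix ι ι (RatFunc ℂ))}
  one_mem' := normalizedAtInfty_one
  mul_mem' := fun ha hb => NormalizedAtInfty.mul ha hb
  inv_mem' := fun {g} hg => NormalizedAtInfty.of_mul_eq_one hg g.mul_inv

/-- Complex conjugation of the coefficients of a rational function: the rational function
`λ ↦ conj (f (conj λ))`, see `eval_conjRat`. -/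
noncomputable def conjRat : RatFunc ℂ →+* RatFunc ℂ :=
  RatFunc.mapRingHom (Polynomial.mapRingHom (starRingEnd ℂ)) fun f hf => by
    rw [Submonoid.mem_comap, mem_nonZeroDivisors_iff_ne_zero]
    rw [mem_nonZeroDivisors_iff_ne_zero] at hf
    simpa [Polynomial.map_eq_zero] using hf

/-- At every point where the denominator of `f` does not vanish, `conjRat f` is
`λ ↦ conj (f (conj λ))`. -/
theorem eval_conjRat (f : RatFunc ℂ) (z : ℂ)
    (hz : f.denom.eval ((starRingEnd ℂ) z) ≠ 0) :
    (conjRat f).eval (RingHom.id ℂ) z =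
      (starRingEnd ℂ) (f.eval (RingHom.id ℂ) ((starRingEnd ℂ) z)) := by
  have hpol : ∀ P : Polynomial ℂ, (P.map (starRingEnd ℂ)).eval z
      = (starRingEnd ℂ) (P.eval ((starRingEnd ℂ) z)) := by
    intro P
    have := Polynomial.eval_map_apply (f := starRingEnd ℂ) (p := P) ((starRingEnd ℂ) z)
    simpa using this
  set N := f.num.map (starRingEnd ℂ) with hN
  set D := f.denom.map (starRingEnd ℂ) with hD
  have hDz : D.eval z ≠ 0 := by
    rw [hD, hpol]; simpa using hz
  have hD0 : D ≠ 0 := fun h => hDz (by simp [h])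
  have hc : conjRat f = algebraMap _ (RatFunc ℂ) N / algebraMap _ (RatFunc ℂ) D := by
    simp only [conjRat, RatFunc.coe_mapRingHom_eq_coe_map]
    rw [RatFunc.map_apply]
    simp [hN, hD]
  have hdvd : (conjRat f).denom ∣ D := by
    rw [hc]; exact RatFunc.denom_div_dvd N D
  have hden : (conjRat f).denom.eval z ≠ 0 := by
    obtain ⟨E, hE⟩ := hdvd
    intro h
    apply hDz
    rw [hE, Polynomial.eval_mul, h, zero_mul]
  have hmul : (conjRat f).num * D = N * (conjRat f).denom := by
    have h := RatFunc.num_div_denom (conjRat f)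
    rw [hc] at h
    rw [← hc] at h
    have hd0 : algebraMap _ (RatFunc ℂ) (conjRat f).denom ≠ 0 :=
      RatFunc.algebraMap_ne_zero (RatFunc.denom_ne_zero _)
    have hD0' : algebraMap _ (RatFunc ℂ) D ≠ 0 := RatFunc.algebraMap_ne_zero hD0
    have h2 := h.trans hc
    rw [div_eq_div_iff hd0 hD0', ← map_mul, ← map_mul] at h2
    exact RatFunc.algebraMap_injective ℂ h2
  have hev := congrArg (Polynomial.eval z) hmul
  rw [Polynomial.eval_mul, Polynomial.eval_mul] at hev
  simp only [RatFunc.eval, Polynomial.eval₂_id, map_div₀]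
  rw [← hpol, ← hpol, ← hN, ← hD, div_eq_div_iff hden hDz, hev]

/-- The index set of `ℂⁿ`, `n = p + q`. -/
abbrev Idx (p q : ℕ) : Type := Fin p ⊕ Fin q

/-- `ℂⁿ`, `n = p + q`. -/
abbrev Vec (p q : ℕ) : Type := Idx p q → ℂ

/-- `s = diag (-I_p, I_q)`, over any ring. -/
def sigMatrix (p q : ℕ) (R : Type*) [Ring R] : Matrix (Idx p q) (Idx p q) R :=
  Matrix.diagonal (Sum.elim (fun _ => -1) (fun _ => 1))

theorem sigMatrix_mul_self (p q : ℕ) (R : Type*) [Ring R] :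
    sigMatrix p q R * sigMatrix p q R = 1 := by
  rw [sigMatrix, Matrix.diagonal_mul_diagonal, ← Matrix.diagonal_one]
  congr 1
  ext i
  rcases i with i | i <;> simp

/-- The Hermitian inner product `⟨v, w⟩ = - ∑_{i ≤ p} conj vᵢ wᵢ + ∑_{i > p} conj vᵢ wᵢ`. -/
def form {p q : ℕ} (v w : Vec p q) : ℂ :=
  -(∑ i : Fin p, (starRingEnd ℂ) (v (Sum.inl i)) * w (Sum.inl i)) +
    ∑ j : Fin q, (starRingEnd ℂ) (v (Sum.inr j)) * w (Sum.inr j)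

/-- The adjoint `A* = s Āᵗ s` of a constant matrix. -/
def adjoint {p q : ℕ} (A : Matrix (Idx p q) (Idx p q) ℂ) : Matrix (Idx p q) (Idx p q) ℂ :=
  sigMatrix p q ℂ * A.conjTranspose * sigMatrix p q ℂ

/-- `adjoint A` is the adjoint of `A` with respect to `form`. -/
theorem form_adjoint {p q : ℕ} (A : Matrix (Idx p q) (Idx p q) ℂ) (v w : Vec p q) :
    form (A.mulVec v) w = form v ((adjoint A).mulVec w) := by
  have hf : ∀ x y : Vec p q, form x y = dotProduct (star x) ((sigMatrix p q ℂ).mulVec y) := by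
    intro x y
    simp [form, dotProduct, sigMatrix, Matrix.mulVec_diagonal, Fintype.sum_sum_type]
  rw [hf, hf, adjoint, Matrix.mulVec_mulVec, ← mul_assoc, ← mul_assoc, sigMatrix_mul_self, one_mul,
    Matrix.star_mulVec, ← Matrix.dotProduct_mulVec, Matrix.mulVec_mulVec]

/-- The loop `λ ↦ g(conj λ)* = s (conj (g (conj λ)))ᵗ s`. -/
noncomputable def loopAdjoint {p q : ℕ} (A : Matrix (Idx p q) (Idx p q) (RatFunc ℂ)) :
    Matrix (Idx p q) (Idx p q) (RatFunc ℂ) :=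
  sigMatrix p q (RatFunc ℂ) * (A.map conjRat).transpose * sigMatrix p q (RatFunc ℂ)

theorem loopAdjoint_one (p q : ℕ) :
    loopAdjoint (1 : Matrix (Idx p q) (Idx p q) (RatFunc ℂ)) = 1 := by
  rw [loopAdjoint, Matrix.map_one _ (map_zero _) (map_one _), Matrix.transpose_one, mul_one,
    sigMatrix_mul_self]

theorem loopAdjoint_mul {p q : ℕ} (A B : Matrix (Idx p q) (Idx p q) (RatFunc ℂ)) :
    loopAdjoint (A * B) = loopAdjoint B * loopAdjoint A := by
  simp only [loopAdjoint, Matrix.map_mul, Matrix.transpose_mul]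
  have h := sigMatrix_mul_self p q (RatFunc ℂ)
  calc _ = sigMatrix p q (RatFunc ℂ) * (B.map conjRat).transpose * 1
        * (A.map conjRat).transpose * sigMatrix p q (RatFunc ℂ) := by
        simp only [mul_one, mul_assoc]
    _ = _ := by rw [← h]; simp only [mul_assoc]

/-- The `U(p,q)`-reality condition `τ(g(conj λ)) = g(λ)`, where `τ(A) = (A*)⁻¹`. -/
def IsUpqReal {p q : ℕ} (A : Matrix (Idx p q) (Idx p q) (RatFunc ℂ)) : Prop :=
  (loopAdjoint A)⁻¹ = A

theorem isUpqReal_iff {p q : ℕ} (g : GL (Idx p q) (RatFunc ℂ)) :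
    IsUpqReal (g : Matrix (Idx p q) (Idx p q) (RatFunc ℂ)) ↔
      loopAdjoint (g : Matrix (Idx p q) (Idx p q) (RatFunc ℂ)) *
        (g : Matrix (Idx p q) (Idx p q) (RatFunc ℂ)) = 1 := by
  constructor
  · intro h
    have hu : IsUnit (loopAdjoint (g : Matrix (Idx p q) (Idx p q) (RatFunc ℂ))) := by
      refine IsUnit.of_mul_eq_one (loopAdjoint (g⁻¹ : GL (Idx p q) (RatFunc ℂ)).val) ?_
      rw [← loopAdjoint_mul, Units.inv_mul, loopAdjoint_one]
    rw [IsUpqReal] at h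
    nth_rewrite 2 [← h]
    exact Matrix.mul_nonsing_inv _ ((Matrix.isUnit_iff_isUnit_det _).mp hu)
  · intro h
    exact Matrix.inv_eq_right_inv h

/-- The rational loop group of `U(p,q)`: the loops in the full rational loop group that satisfy the
`U(p,q)`-reality condition. -/
def loopUpq (p q : ℕ) : Subgroup (GL (Idx p q) (RatFunc ℂ)) where
  carrier := {g | g ∈ loopGL (Idx p q) ∧ IsUpqReal (g : Matrix (Idx p q) (Idx p q) (RatFunc ℂ))}
  one_mem' := ⟨one_mem _, by rw [isUpqReal_iff, Units.val_one, loopAdjoint_one, one_mul]⟩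
  mul_mem' := fun {a b} ha hb => ⟨mul_mem ha.1 hb.1, by
    have h1 := (isUpqReal_iff a).mp ha.2
    have h2 := (isUpqReal_iff b).mp hb.2
    rw [isUpqReal_iff, Units.val_mul, loopAdjoint_mul, mul_assoc,
      ← mul_assoc (loopAdjoint (a : Matrix (Idx p q) (Idx p q) (RatFunc ℂ))), h1, one_mul, h2]⟩
  inv_mem' := fun {a} ha => ⟨inv_mem ha.1, by
    have h1 := (isUpqReal_iff a).mp ha.2
    have h2 : loopAdjoint (a : Matrix (Idx p q) (Idx p q) (RatFunc ℂ)) = (a⁻¹).val := by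
      calc _ = loopAdjoint (a : Matrix (Idx p q) (Idx p q) (RatFunc ℂ)) * (a.val * (a⁻¹).val) := by
            rw [Units.mul_inv, mul_one]
        _ = _ := by rw [← mul_assoc, h1, one_mul]
    rw [isUpqReal_iff, ← h2, ← loopAdjoint_mul, h2, Units.mul_inv, loopAdjoint_one]⟩

/-! ### Subspaces of `ℂⁿ` -/

/-- The orthogonal complement `V^⊥` with respect to `form`. -/
def orth {p q : ℕ} (V : Submodule ℂ (Vec p q)) : Submodule ℂ (Vec p q) where
  carrier := {w | ∀ v ∈ V, form v w = 0}
  zero_mem' := fun v _ => by simp [form]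
  add_mem' := fun {a b} ha hb v hv => by
    have h : form v (a + b) = form v a + form v b := by
      simp only [form, Pi.add_apply, mul_add, Finset.sum_add_distrib]; ring
    rw [h, ha v hv, hb v hv, add_zero]
  smul_mem' := fun c a ha v hv => by
    have h : form v (c • a) = c * form v a := by
      simp only [form, Pi.smul_apply, smul_eq_mul, mul_add, mul_neg, Finset.mul_sum,
        mul_left_comm]
    rw [h, ha v hv, mul_zero]

/-- `V` is isotropic: `form` vanishes identically on `V`. -/
def IsIsotropic {p q : ℕ} (V : Submodule ℂ (Vec p q)) : Prop :=
  ∀ v ∈ V, ∀ w ∈ V, form v w = 0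

/-- The subspace `sV`. -/
noncomputable def sImage {p q : ℕ} (V : Submodule ℂ (Vec p q)) : Submodule ℂ (Vec p q) :=
  V.map (Matrix.toLin' (sigMatrix p q ℂ))

/-! ### Simple elements -/

/-- A constant matrix as a matrix of constant rational functions. -/
noncomputable def const {p q : ℕ} (A : Matrix (Idx p q) (Idx p q) ℂ) :
    Matrix (Idx p q) (Idx p q) (RatFunc ℂ) :=
  A.map RatFunc.C

/-- The constant loop given by the projection of `ℂⁿ` onto `U` along `W`, where `ℂⁿ = U ⊕ W`. -/
noncomputable def proj {p q : ℕ} (U W : Submodule ℂ (Vec p q)) (h : IsCompl U W) :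
    Matrix (Idx p q) (Idx p q) (RatFunc ℂ) :=
  const (LinearMap.toMatrix' (U.projection W h))

/-- The rational function `(λ - a) / (λ - b)`. -/
noncomputable def frac (a b : ℂ) : RatFunc ℂ :=
  (RatFunc.X - RatFunc.C a) / (RatFunc.X - RatFunc.C b)

/-- `p_{α,L} = (λ - α)/(λ - conj α) π_L + π_{L^⊥}`, where `ℂⁿ = L ⊕ L^⊥`. -/
noncomputable def pLoop {p q : ℕ} (α : ℂ) (L : Submodule ℂ (Vec p q)) (h : IsCompl L (orth L)) :
    Matrix (Idx p q) (Idx p q) (RatFunc ℂ) :=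
  frac α ((starRingEnd ℂ) α) • proj L (orth L) h + proj (orth L) L h.symm

/-- `q_{α,β,L} = (λ - α)/(λ - β) π_L + π_{(L ⊕ sL)^⊥} + (λ - conj β)/(λ - conj α) π_{sL}`, with the
projections of the decomposition `ℂⁿ = L ⊕ (L ⊕ sL)^⊥ ⊕ sL`. -/
noncomputable def qLoop {p q : ℕ} (α β : ℂ) (L : Submodule ℂ (Vec p q))
    (h₁ : IsCompl L (orth (L ⊔ sImage L) ⊔ sImage L))
    (h₂ : IsCompl (orth (L ⊔ sImage L)) (L ⊔ sImage L))
    (h₃ : IsCompl (sImage L) (L ⊔ orth (L ⊔ sImage L))) :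
    Matrix (Idx p q) (Idx p q) (RatFunc ℂ) :=
  frac α β • proj L (orth (L ⊔ sImage L) ⊔ sImage L) h₁ +
    proj (orth (L ⊔ sImage L)) (L ⊔ sImage L) h₂ +
    frac ((starRingEnd ℂ) β) ((starRingEnd ℂ) α) •
      proj (sImage L) (L ⊔ orth (L ⊔ sImage L)) h₃

/-- `m_{α,k,N} = I + (λ - α)^{-k} N`. -/
noncomputable def mLoop {p q : ℕ} (α : ℝ) (k : ℕ) (N : Matrix (Idx p q) (Idx p q) ℂ) :
    Matrix (Idx p q) (Idx p q) (RatFunc ℂ) :=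
  1 + (1 / (RatFunc.X - RatFunc.C (α : ℂ))) ^ k • const N

/-- `n_{α,k,N} = I + (λ - α)^{-k} N + (1/2) (λ - α)^{-2k} N²`. -/
noncomputable def nLoop {p q : ℕ} (α : ℝ) (k : ℕ) (N : Matrix (Idx p q) (Idx p q) ℂ) :
    Matrix (Idx p q) (Idx p q) (RatFunc ℂ) :=
  1 + (1 / (RatFunc.X - RatFunc.C (α : ℂ))) ^ k • const N +
    (RatFunc.C (1 / 2 : ℂ) * (1 / (RatFunc.X - RatFunc.C (α : ℂ))) ^ (2 * k)) • const (N ^ 2)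

/-- The loops `p_{α,L}`: `α ∈ ℂ`, `L` a complex line with `ℂⁿ = L ⊕ L^⊥`. -/
def pLoops (p q : ℕ) : Set (Matrix (Idx p q) (Idx p q) (RatFunc ℂ)) :=
  {A | ∃ (α : ℂ) (L : Submodule ℂ (Vec p q)) (h : IsCompl L (orth L)),
    Module.finrank ℂ L = 1 ∧ A = pLoop α L h}

/-- The loops `q_{α,β,L}`: `α, β ∈ ℂ`, `L` an isotropic complex line. -/
def qLoops (p q : ℕ) : Set (Matrix (Idx p q) (Idx p q) (RatFunc ℂ)) :=
  {A | ∃ (α β : ℂ) (L : Submodule ℂ (Vec p q))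
    (h₁ : IsCompl L (orth (L ⊔ sImage L) ⊔ sImage L))
    (h₂ : IsCompl (orth (L ⊔ sImage L)) (L ⊔ sImage L))
    (h₃ : IsCompl (sImage L) (L ⊔ orth (L ⊔ sImage L))),
    Module.finrank ℂ L = 1 ∧ IsIsotropic L ∧ A = qLoop α β L h₁ h₂ h₃}

/-- The loops `m_{α,k,N}`: `α ∈ ℝ`, `k = 1, 2`, `N² = 0`, `N* = -N`, `rank N = 1`. -/
def mLoops (p q : ℕ) : Set (Matrix (Idx p q) (Idx p q) (RatFunc ℂ)) :=
  {A | ∃ (α : ℝ) (k : ℕ) (N : Matrix (Idx p q) (Idx p q) ℂ), (k = 1 ∨ k = 2) ∧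
    N ^ 2 = 0 ∧ adjoint N = -N ∧ N.rank = 1 ∧ A = mLoop α k N}

/-- The loops `n_{α,1,N}`: `α ∈ ℝ`, `N = M - M*`, where `M : (V ⊕ sV)^⊥ → V` is a linear map
(extended by zero on `V ⊕ sV`) for a maximal isotropic subspace `V`, `rank M = 1`, `rank N = 2`. -/
def nLoops (p q : ℕ) : Set (Matrix (Idx p q) (Idx p q) (RatFunc ℂ)) :=
  {A | ∃ (α : ℝ) (V : Submodule ℂ (Vec p q)) (M N : Matrix (Idx p q) (Idx p q) ℂ),
    Maximal IsIsotropic V ∧ (∀ x ∈ V ⊔ sImage V, M.mulVec x = 0) ∧ (∀ x, M.mulVec x ∈ V) ∧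
    N = M - adjoint M ∧ M.rank = 1 ∧ N.rank = 2 ∧ A = nLoop α 1 N}

/-- The group `G` of invertible matrices is generated by the set `S` of matrices: every member of
`S` is (the matrix of) an element of `G`, and the subgroup generated by these elements is `G`. -/
def IsGeneratedBy {ι R : Type*} [Fintype ι] [DecidableEq ι] [CommRing R]
    (G : Subgroup (GL ι R)) (S : Set (Matrix ι ι R)) : Prop :=
  (∀ A ∈ S, ∃ g ∈ G, (g : Matrix ι ι R) = A) ∧
    Subgroup.closure {g : GL ι R | (g : Matrix ι ι R) ∈ S} = G

end RationalLoop

namespace RationalLoop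

open Polynomial Matrix

local notation "K" => RatFunc ℂ

/-! ### Rational functions at infinity. -/

section

/-! Coefficient conjugation is an involution of the field of rational functions, and `loopUpq`
consists of the matrices that are unitary for the Hermitian form `pair` over this field and equal
the identity at infinity. Membership of the simple loops is a direct check: adjoints permute the
projections, and the nilpotent loops are exponentials of skew elements. Generation is Gaussian
elimination. Because of the value at infinity, column `k` of a loop is close to `e_k`, so the
required pivots are automatically invertible.

A column is moved inside the stabilizer of an isotropic line. If `e_k` and `e_l` have opposite
signs, then `v = e_k + e_l` and `u = e_k - e_l` form a hyperbolic pair. It carries semisimple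
elements (`hypTorus`) and a Heisenberg group of unipotents (`unip`), with vector part `w` orthogonal
to `v` and `u` and a skew central parameter `r`. One general unipotent, one semisimple and one
central unipotent element take the column to `e_k` (`exists_gen_mulVec_eq_single`). Once all
coordinates but one are fixed, a diagonal scaling by some `c` with `conjRat c * c = 1` remains; an
explicit Hilbert 90 writes it as a product of loops of type (1) (`gen_scaleSingle`).

It remains to produce these elements. Loops of type (2) give all semisimple elements with parameter
`1` at infinity, since such functions are products of fractions (`gen_hypTorus`). Loops of type (3)
with `α = 0`, `k = 1` are transvections with a simple pole at `0`. Conjugation by semisimple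
elements rescales them, and a difference of two squares then gives every skew central parameter
vanishing at infinity (`gen_unip_zero`). Polarizing transvections gives `unip v (X⁻¹ w) 0` for
isotropic `w` orthogonal to `v`. A basis vector `e_i` is half the sum of the isotropic vectors `e_i
± e_j` whenever a spare `j` of opposite sign exists. No spare exists only if `p = 1 < q`; then `v`
spans a maximal isotropic subspace and loops of type (4) supply the element
(`gen_unip_single_X_inv`). Rescaling and adding coordinates yield all unipotents needed
(`gen_unip`). -/

open scoped Classical in
theorem inftyValuation_div_lt_one_iff {P Q : ℂ[X]} (hQ : Q ≠ 0) :
    RatFunc.inftyValuation ℂ (algebraMap _ K P / algebraMap _ K Q) < 1 ↔ P.degree < Q.degree := by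
  have hQ' : RatFunc.inftyValuation ℂ (algebraMap _ K Q) ≠ 0 :=
    (Valuation.ne_zero_iff _).mpr (RatFunc.algebraMap_ne_zero hQ)
  rw [map_div₀, div_lt_one₀ (zero_lt_iff.mpr hQ')]
  by_cases hP : P = 0
  · simp [hP, zero_lt_iff, hQ, bot_lt_iff_ne_bot]
  · rw [RatFunc.inftyValuation_apply, RatFunc.inftyValuation_apply,
      RatFunc.inftyValuation.polynomial _ hP, RatFunc.inftyValuation.polynomial _ hQ,
      WithZero.exp_lt_exp, Polynomial.degree_eq_natDegree hP, Polynomial.degree_eq_natDegree hQ]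
    norm_cast

theorem hasValueAtInfty_div_iff {P Q : ℂ[X]} (hQ : Q ≠ 0) (c : ℂ) :
    HasValueAtInfty (algebraMap _ K P / algebraMap _ K Q) c ↔
      (P - Polynomial.C c * Q).degree < Q.degree := by
  classical
  have e : algebraMap _ K P / algebraMap _ K Q - RatFunc.C c =
      algebraMap _ K (P - Polynomial.C c * Q) / algebraMap _ K Q := by
    have := RatFunc.algebraMap_ne_zero hQ
    rw [map_sub, map_mul, RatFunc.algebraMap_C]
    field_simp
  rw [HasValueAtInfty, e, inftyValuation_div_lt_one_iff hQ]

theorem hasValueAtInfty_C (c : ℂ) : HasValueAtInfty (RatFunc.C c) c := by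
  simp [HasValueAtInfty]

theorem hasValueAtInfty_zero : HasValueAtInfty 0 0 := by
  simpa using hasValueAtInfty_C 0

theorem hasValueAtInfty_one : HasValueAtInfty 1 1 := by
  simpa using hasValueAtInfty_C 1

namespace HasValueAtInfty

variable {f g : K} {a b : ℂ}

theorem add (hf : HasValueAtInfty f a) (hg : HasValueAtInfty g b) :
    HasValueAtInfty (f + g) (a + b) := by
  classical
  have := (RatFunc.inftyValuation ℂ).map_add_lt hf hg
  rwa [show f - RatFunc.C a + (g - RatFunc.C b) = f + g - RatFunc.C (a + b) by
    rw [map_add]; ring] at this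

theorem neg (hf : HasValueAtInfty f a) : HasValueAtInfty (-f) (-a) := by
  classical
  rw [HasValueAtInfty, map_neg, ← neg_add', Valuation.map_neg, ← sub_eq_add_neg] 
  exact hf

theorem sub (hf : HasValueAtInfty f a) (hg : HasValueAtInfty g b) :
    HasValueAtInfty (f - g) (a - b) := by
  simpa [sub_eq_add_neg] using hf.add hg.neg

theorem valuation_le (hf : HasValueAtInfty f a) [DecidableEq K] :
    RatFunc.inftyValuation ℂ f ≤ 1 := by
  have h2 : RatFunc.inftyValuation ℂ (RatFunc.C a) ≤ 1 := by
    by_cases h : a = 0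
    · simp [h]
    · rw [RatFunc.inftyValuation.C _ h]
  have := (RatFunc.inftyValuation ℂ).map_add (f - RatFunc.C a) (RatFunc.C a)
  rw [sub_add_cancel] at this
  refine this.trans (max_le (le_of_lt ?_) h2)
  rw [HasValueAtInfty] at hf
  convert hf

theorem mul (hf : HasValueAtInfty f a) (hg : HasValueAtInfty g b) :
    HasValueAtInfty (f * g) (a * b) := by
  classical
  have h1 : RatFunc.inftyValuation ℂ ((f - RatFunc.C a) * g) < 1 := by
    rw [map_mul]; exact mul_lt_one_of_nonneg_of_lt_one_left zero_le hf hg.valuation_le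
  have h2 : RatFunc.inftyValuation ℂ (RatFunc.C a * (g - RatFunc.C b)) < 1 := by
    rw [map_mul]
    exact mul_lt_one_of_nonneg_of_lt_one_right (hasValueAtInfty_C a).valuation_le zero_le hg
  have := (RatFunc.inftyValuation ℂ).map_add_lt h1 h2
  rwa [show (f - RatFunc.C a) * g + RatFunc.C a * (g - RatFunc.C b) =
    f * g - RatFunc.C (a * b) by rw [map_mul]; ring] at this

theorem const_mul (c : ℂ) (hf : HasValueAtInfty f a) :
    HasValueAtInfty (RatFunc.C c * f) (c * a) :=
  (hasValueAtInfty_C c).mul hf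

theorem sum {ι : Type*} (s : Finset ι) {f : ι → K} {a : ι → ℂ}
    (h : ∀ i ∈ s, HasValueAtInfty (f i) (a i)) :
    HasValueAtInfty (∑ i ∈ s, f i) (∑ i ∈ s, a i) := by
  classical
  induction s using Finset.induction_on with
  | empty => simpa using hasValueAtInfty_zero
  | insert i s hi ih =>
    rw [Finset.sum_insert hi, Finset.sum_insert hi]
    exact (h i (Finset.mem_insert_self _ _)).add
      (ih fun j hj => h j (Finset.mem_insert_of_mem hj))

theorem unique (hf : HasValueAtInfty f a) (hf' : HasValueAtInfty f b) : a = b := by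
  classical
  by_contra hab
  have h := hf.sub hf'
  rw [sub_self, HasValueAtInfty, zero_sub, Valuation.map_neg,
    RatFunc.inftyValuation.C _ (sub_ne_zero.mpr hab)] at h
  exact lt_irrefl _ h

/-- This is what makes the pivots invertible: the elimination never has to search for a nonzero
entry. -/
theorem ne_zero (hf : HasValueAtInfty f a) (ha : a ≠ 0) : f ≠ 0 := by
  rintro rfl
  exact ha (hf.unique hasValueAtInfty_zero)

theorem exists_div (hf : HasValueAtInfty f a) :
    ∃ P Q : ℂ[X], Q ≠ 0 ∧ f = algebraMap _ K P / algebraMap _ K Q ∧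
      (P - Polynomial.C a * Q).degree < Q.degree := by
  refine ⟨f.num, f.denom, f.denom_ne_zero, (RatFunc.num_div_denom f).symm, ?_⟩
  rwa [← hasValueAtInfty_div_iff f.denom_ne_zero, RatFunc.num_div_denom]

theorem inv (hf : HasValueAtInfty f a) (ha : a ≠ 0) : HasValueAtInfty f⁻¹ a⁻¹ := by
  classical
  have hf0 := hf.ne_zero ha
  have hv : RatFunc.inftyValuation ℂ f = 1 := by
    have h := (RatFunc.inftyValuation ℂ).map_eq_of_sub_lt (x := RatFunc.C a) (y := f) (by
      rw [RatFunc.inftyValuation.C _ ha]; exact hf)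
    rw [h, RatFunc.inftyValuation.C _ ha]
  have hCa : RatFunc.C a ≠ 0 := by simpa using ha
  have e : f⁻¹ - RatFunc.C a⁻¹ = -(f - RatFunc.C a) * f⁻¹ * RatFunc.C a⁻¹ := by
    rw [map_inv₀]; field_simp; ring
  rw [HasValueAtInfty, e, map_mul, map_mul, map_inv₀, hv, RatFunc.inftyValuation.C _ (inv_ne_zero ha),
    Valuation.map_neg, inv_one, mul_one, mul_one]
  exact hf

end HasValueAtInfty

/-! ### Coefficient conjugation and linear fractions. -/

theorem conjRat_algebraMap (P : ℂ[X]) :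
    conjRat (algebraMap _ K P) = algebraMap _ K (P.map (starRingEnd ℂ)) := by
  rw [conjRat, RatFunc.coe_mapRingHom_eq_coe_map]
  simp [RatFunc.map_apply]

@[simp] theorem conjRat_C (c : ℂ) : conjRat (RatFunc.C c) = RatFunc.C ((starRingEnd ℂ) c) := by
  rw [← RatFunc.algebraMap_C, conjRat_algebraMap, Polynomial.map_C, RatFunc.algebraMap_C]

@[simp] theorem conjRat_X : conjRat RatFunc.X = RatFunc.X := by
  rw [← RatFunc.algebraMap_X, conjRat_algebraMap, Polynomial.map_X]

@[simp] theorem conjRat_conjRat (f : K) : conjRat (conjRat f) = f := by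
  rw [← RatFunc.num_div_denom f]
  simp only [map_div₀, conjRat_algebraMap, Polynomial.map_map]
  simp

theorem HasValueAtInfty.conj {f : K} {a : ℂ} (hf : HasValueAtInfty f a) :
    HasValueAtInfty (conjRat f) ((starRingEnd ℂ) a) := by
  obtain ⟨P, Q, hQ, rfl, h⟩ := hf.exists_div
  have hQ' : Q.map (starRingEnd ℂ) ≠ 0 := by simpa using hQ
  rw [map_div₀, conjRat_algebraMap, conjRat_algebraMap, hasValueAtInfty_div_iff hQ',
    ← Polynomial.map_C, ← Polynomial.map_mul, ← Polynomial.map_sub, Polynomial.degree_map,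
    Polynomial.degree_map]
  exact h

theorem hasValueAtInfty_frac (a b : ℂ) : HasValueAtInfty (frac a b) 1 := by
  rw [frac, ← RatFunc.algebraMap_X, ← RatFunc.algebraMap_C, ← RatFunc.algebraMap_C, ← map_sub,
    ← map_sub, hasValueAtInfty_div_iff (Polynomial.X_sub_C_ne_zero b)]
  have : (X - Polynomial.C a - Polynomial.C 1 * (X - Polynomial.C b) : ℂ[X])
      = Polynomial.C (b - a) := by
    simp
  rw [this, Polynomial.degree_X_sub_C]
  exact Polynomial.degree_C_le.trans_lt (by norm_num)

theorem hasValueAtInfty_one_div_X_sub_C (a : ℂ) :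
    HasValueAtInfty (1 / (RatFunc.X - RatFunc.C a)) 0 := by
  rw [← RatFunc.algebraMap_X, ← RatFunc.algebraMap_C, ← map_sub, ← map_one (algebraMap ℂ[X] K),
    hasValueAtInfty_div_iff (Polynomial.X_sub_C_ne_zero a), Polynomial.degree_X_sub_C]
  simp

/-- A rational function vanishing at infinity is `X⁻¹` times one holomorphic at infinity. -/
theorem HasValueAtInfty.exists_X_mul {f : K} (hf : HasValueAtInfty f 0) :
    ∃ c, HasValueAtInfty (RatFunc.X * f) c := by
  obtain ⟨P, Q, hQ, rfl, h⟩ := hf.exists_div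
  rw [map_zero, zero_mul, sub_zero] at h
  have hlc : Q.leadingCoeff ≠ 0 := by simpa using hQ
  -- Since `P` has smaller degree than `Q`, the product `X * P` has degree at most that of `Q`; the
  -- value at infinity is the ratio of the coefficients in that degree.
  refine ⟨(X * P).coeff Q.natDegree / Q.leadingCoeff, ?_⟩
  rw [← RatFunc.algebraMap_X, ← mul_div_assoc, ← map_mul, hasValueAtInfty_div_iff hQ,
    Polynomial.degree_eq_natDegree hQ, Polynomial.degree_lt_iff_coeff_zero]
  intro m hm
  rcases hm.eq_or_lt with rfl | hm
  · rw [Polynomial.coeff_sub, Polynomial.coeff_C_mul, Polynomial.coeff_natDegree]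
    field_simp
    simp
  · obtain ⟨m, rfl⟩ : ∃ k, m = k + 1 := ⟨m - 1, by omega⟩
    rw [Polynomial.coeff_sub, Polynomial.coeff_C_mul, Polynomial.coeff_X_mul,
      Polynomial.coeff_eq_zero_of_natDegree_lt hm, Polynomial.coeff_eq_zero_of_degree_lt]
    · simp
    · refine h.trans_le (Polynomial.degree_le_of_natDegree_le (by omega))

theorem X_sub_C_ne_zero (a : ℂ) : (RatFunc.X - RatFunc.C a : K) ≠ 0 := by
  rw [← RatFunc.algebraMap_X, ← RatFunc.algebraMap_C, ← map_sub]
  exact RatFunc.algebraMap_ne_zero (Polynomial.X_sub_C_ne_zero a)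

theorem frac_mul_frac (a b : ℂ) : frac a b * frac b a = 1 := by
  have := X_sub_C_ne_zero a
  have := X_sub_C_ne_zero b
  rw [frac, frac]; field_simp

@[simp] theorem conjRat_frac (a b : ℂ) :
    conjRat (frac a b) = frac ((starRingEnd ℂ) a) ((starRingEnd ℂ) b) := by
  simp [frac]

/-- Every rational function with value `1` at infinity is a product of functions `frac a b`. -/
theorem HasValueAtInfty.induction_frac {p : K → Prop} (one : p 1)
    (frac_mul : ∀ a b f, HasValueAtInfty f 1 → p f → p (frac a b * f)) {f : K}
    (hf : HasValueAtInfty f 1) : p f := by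
  -- Zeros and poles are equally many and are paired off one at a time; the choice of pairing is
  -- irrelevant.
  have key : ∀ (n : ℕ) (s t : Multiset ℂ), s.card = n → t.card = n →
      HasValueAtInfty (algebraMap _ K (s.map fun a => X - Polynomial.C a).prod /
        algebraMap _ K (t.map fun a => X - Polynomial.C a).prod) 1 ∧
      p (algebraMap _ K (s.map fun a => X - Polynomial.C a).prod /
        algebraMap _ K (t.map fun a => X - Polynomial.C a).prod) := by
    intro n
    induction n with
    | zero =>
      intro s t hs ht
      rw [Multiset.card_eq_zero] at hs ht
      subst hs ht
      simpa using ⟨hasValueAtInfty_one, one⟩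
    | succ n ih =>
      intro s t hs ht
      obtain ⟨a, s, rfl, hs'⟩ := Multiset.card_eq_succ_iff.mp hs
      obtain ⟨b, t, rfl, ht'⟩ := Multiset.card_eq_succ_iff.mp ht
      obtain ⟨h1, h2⟩ := ih s t hs' ht'
      have e : algebraMap _ K ((a ::ₘ s).map fun a => X - Polynomial.C a).prod /
          algebraMap _ K ((b ::ₘ t).map fun a => X - Polynomial.C a).prod =
          frac a b * (algebraMap _ K (s.map fun a => X - Polynomial.C a).prod /
            algebraMap _ K (t.map fun a => X - Polynomial.C a).prod) := by
        simp only [Multiset.map_cons, Multiset.prod_cons, map_mul, map_sub, frac,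
          RatFunc.algebraMap_X, RatFunc.algebraMap_C]
        rw [mul_div_mul_comm]
      rw [e]
      exact ⟨by simpa using (hasValueAtInfty_frac a b).mul h1, frac_mul a b _ h1 h2⟩
  have hd := f.monic_denom
  have hdeg : (f.num - f.denom).degree < f.denom.degree := by
    simpa using (hasValueAtInfty_div_iff f.denom_ne_zero 1).mp (by rwa [RatFunc.num_div_denom])
  -- Value `1` at infinity means that numerator and monic denominator have the same leading term.
  have hn : f.num.Monic := by
    have := hd.add_of_left hdeg
    rwa [add_sub_cancel] at this
  have hdd : f.num.natDegree = f.denom.natDegree := by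
    have := Polynomial.degree_add_eq_left_of_degree_lt hdeg
    rw [add_sub_cancel] at this
    exact Polynomial.natDegree_eq_of_degree_eq this
  have sn := IsAlgClosed.splits f.num
  have sd := IsAlgClosed.splits f.denom
  have h := (key f.num.natDegree f.num.roots f.denom.roots sn.natDegree_eq_card_roots.symm
    (by rw [hdd]; exact sd.natDegree_eq_card_roots.symm)).2
  rw [← sn.eq_prod_roots_of_monic hn, ← sd.eq_prod_roots_of_monic hd, RatFunc.num_div_denom] at h
  exact h

end

section

variable {p q : ℕ}

/-! ### The form and adjoints over `ℂ` -/

theorem form_eq_dotProduct (x y : Vec p q) :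
    form x y = star x ⬝ᵥ (sigMatrix p q ℂ *ᵥ y) := by
  simp [form, dotProduct, sigMatrix, Matrix.mulVec_diagonal, Fintype.sum_sum_type]

theorem form_add_right (x y z : Vec p q) : form x (y + z) = form x y + form x z := by
  simp only [form_eq_dotProduct, Matrix.mulVec_add, dotProduct_add]

theorem form_smul_right (c : ℂ) (x y : Vec p q) : form x (c • y) = c * form x y := by
  simp only [form_eq_dotProduct, Matrix.mulVec_smul, dotProduct_smul, smul_eq_mul]

theorem form_conj (x y : Vec p q) : (starRingEnd ℂ) (form x y) = form y x := by
  simp [form, mul_comm]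

theorem form_add_left (x y z : Vec p q) : form (x + y) z = form x z + form y z := by
  rw [← form_conj, form_add_right, map_add, form_conj, form_conj]

theorem form_smul_left (c : ℂ) (x y : Vec p q) :
    form (c • x) y = (starRingEnd ℂ) c * form x y := by
  rw [← form_conj, form_smul_right, map_mul, form_conj]

theorem form_comm_eq_zero {x y : Vec p q} (h : form x y = 0) : form y x = 0 := by
  rw [← form_conj, h, map_zero]

theorem form_sig_sig (x y : Vec p q) :
    form (sigMatrix p q ℂ *ᵥ x) (sigMatrix p q ℂ *ᵥ y) = form x y := by
  simp [form, sigMatrix, Matrix.mulVec_diagonal]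

/-- Testing against `s y` turns the indefinite form into the positive definite standard one. -/
theorem eq_zero_of_form_eq_zero {y : Vec p q} (h : ∀ x, form x y = 0) : y = 0 := by
  have h1 := h (sigMatrix p q ℂ *ᵥ y)
  have : form (sigMatrix p q ℂ *ᵥ y) y = star y ⬝ᵥ y := by
    simp [form, sigMatrix, Matrix.mulVec_diagonal, dotProduct, Fintype.sum_sum_type]
  rw [this] at h1
  open scoped ComplexOrder in exact dotProduct_star_self_eq_zero.mp h1

theorem eq_of_form_eq {A B : Matrix (Idx p q) (Idx p q) ℂ}
    (h : ∀ x y, form x (A *ᵥ y) = form x (B *ᵥ y)) : A = B := by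
  apply Matrix.toLin'.injective
  refine LinearMap.ext fun y => ?_
  rw [Matrix.toLin'_apply, Matrix.toLin'_apply, ← sub_eq_zero]
  refine eq_zero_of_form_eq_zero fun x => ?_
  rw [sub_eq_add_neg, form_add_right, h x y, ← neg_one_smul ℂ (B *ᵥ _), form_smul_right]
  ring

theorem adjoint_eq_of_form {A B : Matrix (Idx p q) (Idx p q) ℂ}
    (h : ∀ x y, form (A *ᵥ x) y = form x (B *ᵥ y)) : adjoint A = B :=
  eq_of_form_eq fun x y => by rw [← form_adjoint, h]

/-- The matrix of the projection onto `U` along `W`. -/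
noncomputable def projC (U W : Submodule ℂ (Vec p q)) (h : IsCompl U W) :
    Matrix (Idx p q) (Idx p q) ℂ :=
  LinearMap.toMatrix' (U.projection W h)

section projC

variable {U W U' W' : Submodule ℂ (Vec p q)} (h : IsCompl U W)

theorem projC_mulVec (x : Vec p q) : projC U W h *ᵥ x = U.projection W h x := by
  rw [projC, LinearMap.toMatrix'_mulVec]

theorem projC_mem (x : Vec p q) : projC U W h *ᵥ x ∈ U := by
  rw [projC_mulVec]; simp

theorem projC_mulVec_left {x : Vec p q} (hx : x ∈ U) : projC U W h *ᵥ x = x := by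
  rw [projC_mulVec]; exact Submodule.projection_apply_of_mem_left h hx

theorem projC_mulVec_right {x : Vec p q} (hx : x ∈ W) : projC U W h *ᵥ x = 0 := by
  rw [projC_mulVec]; exact Submodule.projection_apply_of_mem_right h hx

theorem sub_projC_mem (x : Vec p q) : x - projC U W h *ᵥ x ∈ W := by
  obtain ⟨a, ha, b, hb, rfl⟩ := Submodule.mem_sup.mp
    (h.sup_eq_top.symm ▸ Submodule.mem_top : x ∈ U ⊔ W)
  rw [Matrix.mulVec_add, projC_mulVec_left h ha, projC_mulVec_right h hb]
  simpa using hb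

/-- Both `form (P x) y` and `form x (P' y)` equal `form (P x) (P' y)`, by the two orthogonality
relations. -/
theorem adjoint_projC (h' : IsCompl U' W') (h1 : ∀ x ∈ U, ∀ y ∈ W', form x y = 0)
    (h2 : ∀ x ∈ W, ∀ y ∈ U', form x y = 0) : adjoint (projC U W h) = projC U' W' h' := by
  refine adjoint_eq_of_form fun x y => ?_
  have e1 := h1 _ (projC_mem h x) _ (sub_projC_mem h' y)
  have e2 := h2 _ (sub_projC_mem h x) _ (projC_mem h' y)
  rw [sub_eq_add_neg, ← neg_one_smul ℂ, form_add_right, form_smul_right] at e1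
  rw [sub_eq_add_neg, ← neg_one_smul ℂ, form_add_left, form_smul_left] at e2
  simp only [map_neg, map_one] at e2
  linear_combination e1 - e2

theorem projC_mul_self : projC U W h * projC U W h = projC U W h := by
  refine eq_of_form_eq fun x y => ?_
  rw [← Matrix.mulVec_mulVec, projC_mulVec_left h (projC_mem h y)]

theorem projC_mul_of_le (h' : IsCompl U' W') (hle : U' ≤ W) :
    projC U W h * projC U' W' h' = 0 := by
  refine eq_of_form_eq fun x y => ?_
  rw [← Matrix.mulVec_mulVec, projC_mulVec_right h (hle (projC_mem h' y)), Matrix.zero_mulVec]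

/-- A matrix with range in `U` that is the identity modulo `W`, the identity on `U` and zero on `W`
is the projection onto `U` along `W`. -/
theorem exists_projC_eq {P : Matrix (Idx p q) (Idx p q) ℂ} (h1 : ∀ x, P *ᵥ x ∈ U)
    (h2 : ∀ x, x - P *ᵥ x ∈ W) (h3 : ∀ x ∈ U, P *ᵥ x = x) (h4 : ∀ x ∈ W, P *ᵥ x = 0) :
    ∃ h : IsCompl U W, projC U W h = P := by
  have h : IsCompl U W := by
    constructor
    · rw [Submodule.disjoint_def]
      intro x hx hx'
      rw [← h3 x hx, h4 x hx']
    · rw [codisjoint_iff, Submodule.eq_top_iff']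
      intro x
      exact Submodule.mem_sup.mpr ⟨_, h1 x, _, h2 x, by simp⟩
  refine ⟨h, eq_of_form_eq fun x y => ?_⟩
  have e1 := projC_mulVec_right h (h2 y)
  rw [Matrix.mulVec_sub, projC_mulVec_left h (h1 y), sub_eq_zero] at e1
  rw [e1]

end projC

/-! ### Constant loops and adjoints over `RatFunc ℂ` -/

theorem const_mul (A B : Matrix (Idx p q) (Idx p q) ℂ) : const (A * B) = const A * const B := by
  simp [const, Matrix.map_mul]

theorem const_add (A B : Matrix (Idx p q) (Idx p q) ℂ) : const (A + B) = const A + const B :=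
  Matrix.map_add _ (map_add _) A B

theorem const_neg (A : Matrix (Idx p q) (Idx p q) ℂ) : const (-A) = -const A :=
  Matrix.map_neg _ (map_neg _) A

theorem const_zero : const (0 : Matrix (Idx p q) (Idx p q) ℂ) = 0 :=
  Matrix.map_zero _ (map_zero _)

theorem const_one : const (1 : Matrix (Idx p q) (Idx p q) ℂ) = 1 :=
  Matrix.map_one _ (map_zero _) (map_one _)

theorem const_smul (c : ℂ) (A : Matrix (Idx p q) (Idx p q) ℂ) :
    const (c • A) = RatFunc.C c • const A := by
  ext i j; simp [const]

theorem loopAdjoint_const (A : Matrix (Idx p q) (Idx p q) ℂ) :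
    loopAdjoint (const A) = const (adjoint A) := by
  have hs : sigMatrix p q K = const (sigMatrix p q ℂ) := by
    ext i j
    by_cases hij : i = j
    · subst hij; rcases i with i | i <;> simp [sigMatrix, const]
    · simp [sigMatrix, const, hij]
  rw [loopAdjoint, adjoint, const_mul, const_mul, hs]
  congr 2
  ext i j
  simp [const]

theorem loopAdjoint_add (A B : Matrix (Idx p q) (Idx p q) K) :
    loopAdjoint (A + B) = loopAdjoint A + loopAdjoint B := by
  rw [loopAdjoint, Matrix.map_add _ (map_add _), Matrix.transpose_add, mul_add, add_mul]
  rfl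

theorem loopAdjoint_smul (f : K) (A : Matrix (Idx p q) (Idx p q) K) :
    loopAdjoint (f • A) = conjRat f • loopAdjoint A := by
  rw [loopAdjoint, Matrix.map_smul' _ _ _ (map_mul conjRat), Matrix.transpose_smul,
    Matrix.mul_smul, Matrix.smul_mul]
  rfl

theorem exists_mem_loopUpq {A : Matrix (Idx p q) (Idx p q) K} (hA : NormalizedAtInfty A)
    (h : loopAdjoint A * A = 1) : ∃ g ∈ loopUpq p q, (g : Matrix (Idx p q) (Idx p q) K) = A := by
  refine ⟨⟨A, loopAdjoint A, mul_eq_one_comm.mp h, h⟩, ⟨hA, ?_⟩, rfl⟩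
  rw [isUpqReal_iff]
  exact h

theorem hasValueAtInfty_const (A : Matrix (Idx p q) (Idx p q) ℂ) (i j : Idx p q) :
    HasValueAtInfty (const A i j) (A i j) :=
  hasValueAtInfty_C _

/-! ### The simple elements are loops in `loopUpq` -/

/-- As `L` and `sL` are isotropic, the adjoint exchanges their projections and fixes the middle one.
The conjugated coefficients are then inverse to the original ones on each summand. -/
theorem exists_mem_loopUpq_of_mem_qLoops {A : Matrix (Idx p q) (Idx p q) K}
    (hA : A ∈ qLoops p q) : ∃ g ∈ loopUpq p q, (g : Matrix (Idx p q) (Idx p q) K) = A := by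
  obtain ⟨α, β, L, h₁, h₂, h₃, -, hL, rfl⟩ := hA
  set Z := orth (L ⊔ sImage L) with hZ
  set P₁ := projC _ _ h₁ with hP₁
  set P₂ := projC _ _ h₂ with hP₂
  set P₃ := projC _ _ h₃ with hP₃
  have eq : qLoop α β L h₁ h₂ h₃ = frac α β • const P₁ + const P₂ +
    frac ((starRingEnd ℂ) β) ((starRingEnd ℂ) α) • const P₃ := rfl
  have hsL : ∀ x ∈ sImage L, ∀ y ∈ sImage L, form x y = 0 := by
    rintro _ ⟨x, hx, rfl⟩ _ ⟨y, hy, rfl⟩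
    rw [Matrix.toLin'_apply, Matrix.toLin'_apply, form_sig_sig]
    exact hL x hx y hy
  have hZ1 : ∀ x ∈ L ⊔ sImage L, ∀ y ∈ Z, form x y = 0 := fun x hx y hy => hy x hx
  have hZ2 : ∀ x ∈ Z, ∀ y ∈ L ⊔ sImage L, form x y = 0 := fun x hx y hy =>
    form_comm_eq_zero (hx y hy)
  have sup2 : ∀ {U V : Submodule ℂ (Vec p q)} {x : Vec p q}, (∀ y ∈ U, form x y = 0) →
      (∀ y ∈ V, form x y = 0) → ∀ y ∈ U ⊔ V, form x y = 0 := by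
    intro U V x hU hV y hy
    obtain ⟨a, ha, b, hb, rfl⟩ := Submodule.mem_sup.mp hy
    rw [form_add_right, hU a ha, hV b hb, add_zero]
  have a1 : adjoint P₁ = P₃ := by
    refine adjoint_projC h₁ h₃ (fun x hx => sup2 (hL x hx)
      (hZ1 x (Submodule.mem_sup_left hx))) fun x hx y hy => form_comm_eq_zero ?_
    exact sup2 (hZ1 y (Submodule.mem_sup_right hy)) (hsL y hy) x hx
  have a2 : adjoint P₂ = P₂ := adjoint_projC h₂ h₂ hZ2 hZ1
  have a3 : adjoint P₃ = P₁ := by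
    refine adjoint_projC h₃ h₁ (fun x hx => sup2 (hZ1 x (Submodule.mem_sup_right hx))
      (hsL x hx)) fun x hx y hy => form_comm_eq_zero ?_
    exact sup2 (hL y hy) (hZ1 y (Submodule.mem_sup_left hy)) x hx
  have m12 : P₁ * P₂ = 0 := projC_mul_of_le _ _ le_sup_left
  have m13 : P₁ * P₃ = 0 := projC_mul_of_le _ _ le_sup_right
  have m21 : P₂ * P₁ = 0 := projC_mul_of_le _ _ le_sup_left
  have m23 : P₂ * P₃ = 0 := projC_mul_of_le _ _ le_sup_right
  have m31 : P₃ * P₁ = 0 := projC_mul_of_le _ _ le_sup_left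
  have m32 : P₃ * P₂ = 0 := projC_mul_of_le _ _ le_sup_right
  have s : P₁ + P₂ + P₃ = 1 := by
    refine eq_of_form_eq fun x y => ?_
    obtain ⟨a, ha, b, hb, rfl⟩ := Submodule.mem_sup.mp
      (h₁.sup_eq_top.symm ▸ Submodule.mem_top : y ∈ L ⊔ (Z ⊔ sImage L))
    obtain ⟨b, hb', c, hc, rfl⟩ := Submodule.mem_sup.mp hb
    simp only [Matrix.mulVec_add, Matrix.add_mulVec, Matrix.one_mulVec]
    rw [projC_mulVec_left h₁ ha, projC_mulVec_right h₁ (Submodule.mem_sup_left hb'),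
      projC_mulVec_right h₁ (Submodule.mem_sup_right hc), projC_mulVec_left h₂ hb',
      projC_mulVec_right h₂ (Submodule.mem_sup_left ha),
      projC_mulVec_right h₂ (Submodule.mem_sup_right hc), projC_mulVec_left h₃ hc,
      projC_mulVec_right h₃ (Submodule.mem_sup_left ha),
      projC_mulVec_right h₃ (Submodule.mem_sup_right hb')]
    congr 1
    abel
  rw [eq]
  apply exists_mem_loopUpq
  · intro i j
    have h := (((hasValueAtInfty_frac α β).mul (hasValueAtInfty_const P₁ i j)).add
      (hasValueAtInfty_const P₂ i j)).add ((hasValueAtInfty_frac ((starRingEnd ℂ) β)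
      ((starRingEnd ℂ) α)).mul (hasValueAtInfty_const P₃ i j))
    rw [one_mul, one_mul, ← Matrix.add_apply, ← Matrix.add_apply, s] at h
    exact h
  · simp only [loopAdjoint_add, loopAdjoint_smul, loopAdjoint_const, a1, a2, a3, conjRat_frac,
      Complex.conj_conj, mul_add, add_mul, smul_mul_smul_comm, Matrix.smul_mul, Matrix.mul_smul,
      ← const_mul, m12, m13, m21, m23, m31, m32, const_zero, smul_zero, add_zero, zero_add,
      frac_mul_frac, one_smul]
    rw [projC_mul_self, projC_mul_self, projC_mul_self, ← const_one, ← s, const_add, const_add]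

theorem exists_mem_loopUpq_of_mem_pLoops {A : Matrix (Idx p q) (Idx p q) K}
    (hA : A ∈ pLoops p q) : ∃ g ∈ loopUpq p q, (g : Matrix (Idx p q) (Idx p q) K) = A := by
  obtain ⟨α, L, h, -, rfl⟩ := hA
  set P := projC _ _ h with hP
  set P' := projC _ _ h.symm with hP'
  have eq : pLoop α L h = frac α ((starRingEnd ℂ) α) • const P + const P' := rfl
  have o1 : ∀ x ∈ L, ∀ y ∈ orth L, form x y = 0 := fun x hx y hy => hy x hx
  have o2 : ∀ x ∈ orth L, ∀ y ∈ L, form x y = 0 := fun x hx y hy => form_comm_eq_zero (hx y hy)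
  have a : adjoint P = P := adjoint_projC h h o1 o2
  have a' : adjoint P' = P' := adjoint_projC h.symm h.symm o2 o1
  have m : P * P' = 0 := projC_mul_of_le _ _ le_rfl
  have m' : P' * P = 0 := projC_mul_of_le _ _ le_rfl
  have s : P + P' = 1 := by
    refine eq_of_form_eq fun x y => ?_
    obtain ⟨a, ha, b, hb, rfl⟩ := Submodule.mem_sup.mp
      (h.sup_eq_top.symm ▸ Submodule.mem_top : y ∈ L ⊔ orth L)
    simp only [Matrix.mulVec_add, Matrix.add_mulVec, Matrix.one_mulVec]
    rw [projC_mulVec_left h ha, projC_mulVec_right h hb, projC_mulVec_left h.symm hb,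
      projC_mulVec_right h.symm ha]
    simp
  rw [eq]
  apply exists_mem_loopUpq
  · intro i j
    have h := ((hasValueAtInfty_frac α ((starRingEnd ℂ) α)).mul (hasValueAtInfty_const P i j)).add
      (hasValueAtInfty_const P' i j)
    rw [one_mul, ← Matrix.add_apply, s] at h
    exact h
  · simp only [loopAdjoint_add, loopAdjoint_smul, loopAdjoint_const, a, a', conjRat_frac,
      Complex.conj_conj, mul_add, add_mul, smul_mul_smul_comm, Matrix.smul_mul, Matrix.mul_smul,
      ← const_mul, m, m', const_zero, smul_zero, add_zero, zero_add,
      frac_mul_frac, one_smul]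
    rw [projC_mul_self, projC_mul_self, ← const_one, ← s, const_add]

theorem conjRat_one_div_X_sub_C (α : ℝ) :
    conjRat (1 / (RatFunc.X - RatFunc.C (α : ℂ))) = 1 / (RatFunc.X - RatFunc.C (α : ℂ)) := by
  simp

theorem exists_mem_loopUpq_of_mem_mLoops {A : Matrix (Idx p q) (Idx p q) K}
    (hA : A ∈ mLoops p q) : ∃ g ∈ loopUpq p q, (g : Matrix (Idx p q) (Idx p q) K) = A := by
  obtain ⟨α, k, N, hk, hN, ha, -, rfl⟩ := hA
  have hk0 : k ≠ 0 := by omega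
  apply exists_mem_loopUpq
  · intro i j
    have h0 : HasValueAtInfty ((1 / (RatFunc.X - RatFunc.C (α : ℂ))) ^ k) 0 := by
      rcases hk with rfl | rfl
      · simpa using hasValueAtInfty_one_div_X_sub_C (α : ℂ)
      · simpa [sq] using (hasValueAtInfty_one_div_X_sub_C (α : ℂ)).mul
          (hasValueAtInfty_one_div_X_sub_C (α : ℂ))
    have h := (hasValueAtInfty_const (1 : Matrix (Idx p q) (Idx p q) ℂ) i j).add
      (h0.mul (hasValueAtInfty_const N i j))
    rw [zero_mul, add_zero, const_one] at h
    exact h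
  · have hN' : N * N = 0 := by rw [← sq, hN]
    rw [mLoop, loopAdjoint_add, loopAdjoint_one, loopAdjoint_smul, loopAdjoint_const, ha, map_pow,
      conjRat_one_div_X_sub_C]
    simp only [mul_add, add_mul, one_mul, mul_one, smul_mul_smul_comm, ← const_mul, neg_mul, hN',
      neg_zero, const_zero, smul_zero, add_zero, const_neg, smul_neg]
    abel

theorem adjoint_adjoint (A : Matrix (Idx p q) (Idx p q) ℂ) : adjoint (adjoint A) = A :=
  adjoint_eq_of_form fun x y => by
    rw [← form_conj, ← form_adjoint, form_conj]

theorem adjoint_mul (A B : Matrix (Idx p q) (Idx p q) ℂ) :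
    adjoint (A * B) = adjoint B * adjoint A :=
  adjoint_eq_of_form fun x y => by
    rw [← Matrix.mulVec_mulVec, ← Matrix.mulVec_mulVec, form_adjoint, form_adjoint]

theorem adjoint_sub (A B : Matrix (Idx p q) (Idx p q) ℂ) :
    adjoint (A - B) = adjoint A - adjoint B := by
  rw [adjoint, Matrix.conjTranspose_sub, mul_sub, sub_mul]
  rfl

/-- The range of `M` is isotropic and killed by `M`, so `N² = -M M*` and `N³ = 0`. The loop is
therefore the exponential of `(λ - α)⁻¹ N`, and as `N* = -N` with `α` real, its adjoint is the
exponential of the negative. -/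
theorem exists_mem_loopUpq_of_mem_nLoops {A : Matrix (Idx p q) (Idx p q) K}
    (hA : A ∈ nLoops p q) : ∃ g ∈ loopUpq p q, (g : Matrix (Idx p q) (Idx p q) K) = A := by
  obtain ⟨α, V, M, N, hV, hM0, hMV, hN, -, -, rfl⟩ := hA
  have hMM : M * M = 0 := eq_of_form_eq fun x y => by
    rw [← Matrix.mulVec_mulVec, hM0 _ (Submodule.mem_sup_left (hMV y)), Matrix.zero_mulVec]
  have hMM' : adjoint M * M = 0 := eq_of_form_eq fun x y => by
    rw [← Matrix.mulVec_mulVec, ← form_adjoint, hV.prop _ (hMV x) _ (hMV y), Matrix.zero_mulVec]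
    simp [form]
  have hM'M' : adjoint M * adjoint M = 0 := by
    rw [← adjoint_mul, hMM]; simp [adjoint]
  have ha : adjoint N = -N := by rw [hN, adjoint_sub, adjoint_adjoint, neg_sub]
  have h2 : N * N = -(M * adjoint M) := by
    rw [hN]; simp [sub_mul, mul_sub, hMM, hMM', hM'M']
  have h3 : N * (N * N) = 0 := by
    rw [h2, hN, sub_mul, mul_neg, mul_neg, ← mul_assoc, ← mul_assoc, hMM, hMM']; simp
  have h3' : N * N * N = 0 := by rw [mul_assoc, h3]
  have h4 : N * N * (N * N) = 0 := by rw [mul_assoc, h3, mul_zero]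
  have ha2 : adjoint (N * N) = N * N := by rw [adjoint_mul, ha, neg_mul_neg]
  set t : K := 1 / (RatFunc.X - RatFunc.C (α : ℂ)) with ht
  have eq : nLoop α 1 N = 1 + t • const N + (RatFunc.C (1 / 2 : ℂ) * (t * t)) • const (N * N) := by
    rw [nLoop, ← ht]; simp only [mul_one, pow_one, sq]
  have ht0 : HasValueAtInfty t 0 := hasValueAtInfty_one_div_X_sub_C _
  rw [eq]
  apply exists_mem_loopUpq
  · intro i j
    have h := ((hasValueAtInfty_const (1 : Matrix (Idx p q) (Idx p q) ℂ) i j).add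
      (ht0.mul (hasValueAtInfty_const N i j))).add
      (((ht0.mul ht0).const_mul (1 / 2 : ℂ)).mul (hasValueAtInfty_const (N * N) i j))
    simp only [zero_mul, add_zero, mul_zero, const_one] at h
    exact h
  · have hC : RatFunc.C (1 / 2 : ℂ) + RatFunc.C (1 / 2 : ℂ) = 1 := by
      rw [← map_add]; norm_num
    have hc : (starRingEnd ℂ) (1 / 2 : ℂ) = 1 / 2 := by simp [Complex.conj_ofNat]
    simp only [loopAdjoint_add, loopAdjoint_one, loopAdjoint_smul, loopAdjoint_const, ha, ha2,
      map_mul, conjRat_C, hc, ht, conjRat_one_div_X_sub_C]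
    rw [← ht]
    simp only [mul_add, add_mul, one_mul, mul_one, smul_mul_smul_comm, ← const_mul, neg_mul, h3,
      h3', h4, neg_zero, const_zero, smul_zero, add_zero, const_neg, smul_neg]
    have : (t * t) • const (N * N) = (RatFunc.C (1 / 2 : ℂ) * (t * t)) • const (N * N) +
        (RatFunc.C (1 / 2 : ℂ) * (t * t)) • const (N * N) := by
      rw [← add_smul, ← add_mul, hC, one_mul]
    rw [this]
    abel

end

section

variable {p q : ℕ}

/-! ### The Hermitian form over `RatFunc ℂ` and rank one matrices -/

/-- The diagonal entries of `sigMatrix`. -/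
def sgn (R : Type*) [Ring R] : Idx p q → R := Sum.elim (fun _ => -1) (fun _ => 1)

theorem sgn_mul_self {R : Type*} [Ring R] (i : Idx p q) : sgn R i * sgn R i = 1 := by
  rcases i with i | i <;> simp [sgn]

@[simp] theorem conjRat_sgn (i : Idx p q) : conjRat (sgn K i) = sgn K i := by
  rcases i with i | i <;> simp [sgn]

@[simp] theorem conj_sgn (i : Idx p q) : (starRingEnd ℂ) (sgn ℂ i) = sgn ℂ i := by
  rcases i with i | i <;> simp [sgn]

@[simp] theorem C_sgn (i : Idx p q) : RatFunc.C (sgn ℂ i) = sgn K i := by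
  rcases i with i | i <;> simp [sgn]

theorem sgn_ne_zero {R : Type*} [Ring R] [Nontrivial R] (i : Idx p q) : sgn R i ≠ 0 := by
  rcases i with i | i <;> simp [sgn]

/-- The Hermitian form on `(RatFunc ℂ)ⁿ`. -/
noncomputable def pair (x y : Idx p q → K) : K := ∑ i, sgn K i * conjRat (x i) * y i

/-- The matrix `z ↦ ⟨y, z⟩ x`. -/
noncomputable def outer (x y : Idx p q → K) : Matrix (Idx p q) (Idx p q) K :=
  Matrix.vecMulVec x fun j => sgn K j * conjRat (y j)

/-- The matrix `z ↦ ⟨y, z⟩ x` over `ℂ`. -/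
noncomputable def outerC (x y : Vec p q) : Matrix (Idx p q) (Idx p q) ℂ :=
  Matrix.vecMulVec x fun j => sgn ℂ j * (starRingEnd ℂ) (y j)

/-- A constant vector as a vector of constant rational functions. -/
noncomputable def constVec (x : Vec p q) : Idx p q → K := fun i => RatFunc.C (x i)

section pair

variable (x y z : Idx p q → K) (f : K)

theorem pair_add_right : pair x (y + z) = pair x y + pair x z := by
  simp [pair, mul_add, Finset.sum_add_distrib]

theorem pair_smul_right : pair x (f • y) = f * pair x y := by
  simp only [pair, Pi.smul_apply, smul_eq_mul, Finset.mul_sum]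
  exact Finset.sum_congr rfl fun i _ => by ring

theorem pair_add_left : pair (x + y) z = pair x z + pair y z := by
  simp [pair, mul_add, add_mul, Finset.sum_add_distrib]

theorem pair_smul_left : pair (f • x) y = conjRat f * pair x y := by
  simp only [pair, Pi.smul_apply, smul_eq_mul, Finset.mul_sum, map_mul]
  exact Finset.sum_congr rfl fun i _ => by ring

@[simp] theorem pair_zero_right : pair x 0 = 0 := by simp [pair]

@[simp] theorem pair_zero_left : pair 0 x = 0 := by simp [pair]

theorem conjRat_pair : conjRat (pair x y) = pair y x := by
  simp only [pair, map_sum, map_mul, conjRat_conjRat, conjRat_sgn]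
  exact Finset.sum_congr rfl fun i _ => by ring

theorem pair_single_left (i : Idx p q) : pair (Pi.single i f) y = sgn K i * conjRat f * y i := by
  rw [pair, Finset.sum_eq_single i]
  · simp
  · intro j _ hj; simp [Pi.single_eq_of_ne hj]
  · simp

theorem pair_single_right (i : Idx p q) :
    pair x (Pi.single i f) = sgn K i * conjRat (x i) * f := by
  rw [← conjRat_pair, pair_single_left]; simp [mul_right_comm]

theorem outer_mulVec : outer x y *ᵥ z = pair y z • x := by
  ext i
  simp only [outer, Matrix.mulVec, dotProduct, Matrix.vecMulVec_apply, pair, Pi.smul_apply,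
    smul_eq_mul, Finset.sum_mul]
  exact Finset.sum_congr rfl fun i _ => by ring

theorem outer_mul_outer (w : Idx p q → K) :
    outer x y * outer z w = pair y z • outer x w := by
  ext i j
  simp only [outer, Matrix.mul_apply, Matrix.vecMulVec_apply, pair, Matrix.smul_apply,
    smul_eq_mul, Finset.sum_mul]
  exact Finset.sum_congr rfl fun i _ => by ring

theorem outer_add_left : outer (x + y) z = outer x z + outer y z := by
  ext i j; simp [outer, Matrix.vecMulVec_apply, add_mul]

theorem outer_add_right : outer x (y + z) = outer x y + outer x z := by
  ext i j; simp [outer, Matrix.vecMulVec_apply, mul_add]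

theorem outer_smul_left : outer (f • x) z = f • outer x z := by
  ext i j; simp [outer, Matrix.vecMulVec_apply, mul_assoc]

theorem outer_smul_right : outer x (f • y) = conjRat f • outer x y := by
  ext i j; simp [outer, Matrix.vecMulVec_apply]; ring

end pair

theorem pair_constVec (x y : Vec p q) : pair (constVec x) (constVec y) = RatFunc.C (form x y) := by
  simp [pair, constVec, form, Fintype.sum_sum_type, sgn, map_sum]

theorem const_outerC (x y : Vec p q) : const (outerC x y) = outer (constVec x) (constVec y) := by
  ext i j; simp [const, outerC, outer, constVec, Matrix.vecMulVec_apply]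

theorem outerC_mulVec (x y z : Vec p q) : outerC x y *ᵥ z = form y z • x := by
  ext i
  rw [Pi.smul_apply, smul_eq_mul, outerC, Matrix.vecMulVec_mulVec]
  simp [form, dotProduct, Fintype.sum_sum_type, sgn, mul_comm]

theorem adjoint_outerC (x y : Vec p q) : adjoint (outerC x y) = outerC y x :=
  adjoint_eq_of_form fun u v => by
    rw [outerC_mulVec, outerC_mulVec, form_smul_left, form_smul_right, form_conj, mul_comm]

theorem outerC_mul_outerC (x y z w : Vec p q) :
    outerC x y * outerC z w = form y z • outerC x w :=
  eq_of_form_eq fun u v => by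
    rw [← Matrix.mulVec_mulVec, outerC_mulVec, outerC_mulVec, Matrix.smul_mulVec, outerC_mulVec,
      form_smul_right, form_smul_right, form_smul_right, form_smul_right]
    ring

/-! ### Unipotent and semisimple elements -/

/-- The unipotent element
`z ↦ z + ⟨w, z⟩ v - ⟨v, z⟩ w + (r - ⟨w, w⟩ / 2) ⟨v, z⟩ v`. -/
noncomputable def unip (v w : Idx p q → K) (r : K) : Matrix (Idx p q) (Idx p q) K :=
  1 + outer v w - outer w v + (r - pair w w / 2) • outer v v

theorem unip_mulVec (v w z : Idx p q → K) (r : K) :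
    unip v w r *ᵥ z = z + pair w z • v - pair v z • w + ((r - pair w w / 2) * pair v z) • v := by
  simp only [unip, Matrix.add_mulVec, Matrix.sub_mulVec, Matrix.one_mulVec, outer_mulVec,
    Matrix.smul_mulVec, smul_smul]

/-- The Heisenberg group law. Under these orthogonality relations `unip v w r` is the exponential of
`outer v w - outer w v + r • outer v v`; its quadratic term is the summand with `pair w w / 2`. -/
theorem unip_mul_unip {v w w' : Idx p q → K} (hv : pair v v = 0) (hw : pair v w = 0)
    (hw' : pair v w' = 0) (r r' : K) : unip v w r * unip v w' r' =
      unip v (w + w') (r + r' + (pair w' w - pair w w') / 2) := by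
  have hw1 : pair w v = 0 := by rw [← conjRat_pair, hw, map_zero]
  simp only [unip, mul_add, add_mul, mul_sub, sub_mul, one_mul, mul_one, Matrix.smul_mul,
    Matrix.mul_smul, outer_mul_outer, hv, hw', hw1, zero_smul, smul_zero, outer_add_left,
    outer_add_right, pair_add_left, pair_add_right]
  ext i j
  simp only [Matrix.add_apply, Matrix.sub_apply, Matrix.smul_apply, smul_eq_mul, Matrix.zero_apply]
  ring

/-- For isotropic `v, u` with `c ⟨u, v⟩ = 1`: the element that scales `v` by `a` and `u` by
the inverse of the conjugate of `a`. -/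
noncomputable def torus (v u : Idx p q → K) (c a : K) : Matrix (Idx p q) (Idx p q) K :=
  1 + ((a - 1) * c) • outer v u + (((conjRat a)⁻¹ - 1) * c) • outer u v

theorem torus_mulVec (v u z : Idx p q → K) (c a : K) : torus v u c a *ᵥ z =
    z + ((a - 1) * c * pair u z) • v + (((conjRat a)⁻¹ - 1) * c * pair v z) • u := by
  simp only [torus, Matrix.add_mulVec, Matrix.one_mulVec, outer_mulVec, Matrix.smul_mulVec,
    smul_smul]

section torus

variable {v u : Idx p q → K} {c : K}

theorem torus_mul_torus (hv : pair v v = 0) (hu : pair u u = 0) (huv : c * pair u v = 1)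
    (hvu : c * pair v u = 1) (a b : K) : torus v u c a * torus v u c b = torus v u c (a * b) := by
  simp only [torus, mul_add, add_mul, one_mul, mul_one, Matrix.smul_mul,
    Matrix.mul_smul, outer_mul_outer, hv, hu, zero_smul, smul_zero, smul_smul, map_mul, mul_inv]
  ext i j
  simp only [Matrix.add_apply, Matrix.smul_apply, smul_eq_mul, Matrix.zero_apply]
  linear_combination (a - 1) * (b - 1) * c * outer v u i j * huv +
    ((conjRat a)⁻¹ - 1) * ((conjRat b)⁻¹ - 1) * c * outer u v i j * hvu

/-- The torus fixes `w` and scales `v` by `a`. This rescaling lets a few unipotents with a simple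
pole produce all the others. -/
theorem torus_mul_unip (hv : pair v v = 0) (huv : c * pair u v = 1)
    (hvu : c * pair v u = 1) {w : Idx p q → K} (hw : pair v w = 0) (hw' : pair u w = 0) {a : K}
    (ha : a ≠ 0) (r : K) : torus v u c a * unip v w r =
      unip v (conjRat a • w) (a * conjRat a * r) * torus v u c a := by
  have hwv : pair w v = 0 := by rw [← conjRat_pair, hw, map_zero]
  have hwu : pair w u = 0 := by rw [← conjRat_pair, hw', map_zero]
  have ha' : conjRat a ≠ 0 := by simpa using ha
  simp only [torus, unip, mul_add, add_mul, mul_sub, sub_mul, one_mul, mul_one, Matrix.smul_mul,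
    Matrix.mul_smul, outer_mul_outer, hv, hw, hw', hwv, hwu, zero_smul, smul_zero, smul_smul,
    outer_smul_left, outer_smul_right, pair_smul_left, pair_smul_right, conjRat_conjRat]
  ext i j
  simp only [Matrix.add_apply, Matrix.sub_apply, Matrix.smul_apply, smul_eq_mul, Matrix.zero_apply]
  have e1 : conjRat a * (conjRat a)⁻¹ = 1 := mul_inv_cancel₀ ha'
  linear_combination (a - 1) * (outer v w i j + (r - pair w w / 2) * outer v v i j) * huv +
    ((conjRat a)⁻¹ - 1) * conjRat a * (outer w v i j - a * (r - pair w w / 2) * outer v v i j) * hvu +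
    (outer w v i j - a * (r - pair w w / 2) * outer v v i j) * e1

end torus

end

section

variable {p q : ℕ}

/-! ### Hyperbolic pairs of constant vectors -/

theorem form_eq_sum (x y : Vec p q) : form x y = ∑ i, sgn ℂ i * (starRingEnd ℂ) (x i) * y i := by
  simp [form, Fintype.sum_sum_type, sgn]

theorem form_single_left (i : Idx p q) (a : ℂ) (y : Vec p q) :
    form (Pi.single i a) y = sgn ℂ i * (starRingEnd ℂ) a * y i := by
  rw [form_eq_sum, Finset.sum_eq_single i]
  · simp
  · intro j _ hj; simp [Pi.single_eq_of_ne hj]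
  · simp

theorem form_single_right (i : Idx p q) (a : ℂ) (x : Vec p q) :
    form x (Pi.single i a) = sgn ℂ i * (starRingEnd ℂ) (x i) * a := by
  rw [← form_conj, form_single_left]; simp [mul_right_comm]

theorem sig_mulVec_apply (x : Vec p q) (i : Idx p q) :
    (sigMatrix p q ℂ *ᵥ x) i = sgn ℂ i * x i := by
  simp [sigMatrix, Matrix.mulVec_diagonal, sgn]

/-- The vector `e_k + ε e_l`. -/
noncomputable def twoVec (k l : Idx p q) (ε : ℂ) : Vec p q := Pi.single k 1 + Pi.single l ε

theorem form_twoVec_left (k l : Idx p q) (ε : ℂ) (y : Vec p q) :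
    form (twoVec k l ε) y = sgn ℂ k * y k + sgn ℂ l * (starRingEnd ℂ) ε * y l := by
  rw [twoVec, form_add_left, form_single_left, form_single_left]; simp

theorem twoVec_apply_left {k l : Idx p q} (h : k ≠ l) (ε : ℂ) : twoVec k l ε k = 1 := by
  simp [twoVec, Pi.single_eq_of_ne h]

theorem twoVec_apply_right {k l : Idx p q} (h : k ≠ l) (ε : ℂ) : twoVec k l ε l = ε := by
  simp [twoVec, Pi.single_eq_of_ne h.symm]

theorem twoVec_apply_of_ne {k l i : Idx p q} (h : i ≠ k) (h' : i ≠ l) (ε : ℂ) :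
    twoVec k l ε i = 0 := by
  simp [twoVec, Pi.single_eq_of_ne h, Pi.single_eq_of_ne h']

theorem ne_of_sgn {k l : Idx p q} (h : sgn ℂ k = -sgn ℂ l) : k ≠ l := by
  rintro rfl
  exact sgn_ne_zero (R := ℂ) k (self_eq_neg.mp h)

theorem form_twoVec_twoVec {k l : Idx p q} (h : sgn ℂ k = -sgn ℂ l) (ε δ : ℂ) :
    form (twoVec k l ε) (twoVec k l δ) = sgn ℂ k * (1 - (starRingEnd ℂ) ε * δ) := by
  rw [form_twoVec_left, twoVec_apply_left (ne_of_sgn h), twoVec_apply_right (ne_of_sgn h), h]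
  ring

theorem sImage_span_twoVec {k l : Idx p q} (h : sgn ℂ k = -sgn ℂ l) :
    sImage (ℂ ∙ twoVec k l 1) = ℂ ∙ twoVec k l (-1) := by
  have e : sigMatrix p q ℂ *ᵥ twoVec k l 1 = sgn ℂ k • twoVec k l (-1) := by
    ext i
    rw [sig_mulVec_apply, Pi.smul_apply, smul_eq_mul]
    have hkl := ne_of_sgn h
    by_cases hik : i = k
    · rw [hik, twoVec_apply_left hkl, twoVec_apply_left hkl]
    · by_cases hil : i = l
      · rw [hil, twoVec_apply_right hkl, twoVec_apply_right hkl, h]; ring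
      · rw [twoVec_apply_of_ne hik hil, twoVec_apply_of_ne hik hil, mul_zero, mul_zero]
  rw [sImage, Submodule.map_span, Set.image_singleton, Matrix.toLin'_apply, e,
    Submodule.span_singleton_smul_eq (IsUnit.mk0 _ (sgn_ne_zero k))]

theorem mem_orth_span_pair {v u x : Vec p q} :
    x ∈ orth ((ℂ ∙ v) ⊔ (ℂ ∙ u)) ↔ form v x = 0 ∧ form u x = 0 := by
  constructor
  · intro h
    exact ⟨h v (Submodule.mem_sup_left (Submodule.mem_span_singleton_self v)),
      h u (Submodule.mem_sup_right (Submodule.mem_span_singleton_self u))⟩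
  · rintro ⟨h1, h2⟩ y hy
    obtain ⟨a, ha, b, hb, rfl⟩ := Submodule.mem_sup.mp hy
    obtain ⟨s, rfl⟩ := Submodule.mem_span_singleton.mp ha
    obtain ⟨t, rfl⟩ := Submodule.mem_span_singleton.mp hb
    rw [form_add_left, form_smul_left, form_smul_left, h1, h2, mul_zero, mul_zero, add_zero]

theorem isIsotropic_span {v : Vec p q} (h : form v v = 0) : IsIsotropic (ℂ ∙ v) := by
  intro x hx y hy
  obtain ⟨s, rfl⟩ := Submodule.mem_span_singleton.mp hx
  obtain ⟨t, rfl⟩ := Submodule.mem_span_singleton.mp hy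
  rw [form_smul_left, form_smul_right, h, mul_zero, mul_zero]

theorem twoVec_ne_zero {k l : Idx p q} (h : k ≠ l) (ε : ℂ) : twoVec k l ε ≠ 0 := by
  intro h0
  have := twoVec_apply_left h ε
  rw [h0] at this
  simp at this

/-! ### Matrices of elements of the subgroup generated by a set of loops -/

/-- `A` is the matrix of an element of the group generated by the loops in `S`. -/
def Gen (S : Set (Matrix (Idx p q) (Idx p q) K)) (A : Matrix (Idx p q) (Idx p q) K) : Prop :=
  ∃ g ∈ Subgroup.closure {g : GL (Idx p q) K | (g : Matrix (Idx p q) (Idx p q) K) ∈ S},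
    (g : Matrix (Idx p q) (Idx p q) K) = A

variable {S : Set (Matrix (Idx p q) (Idx p q) K)} {A B : Matrix (Idx p q) (Idx p q) K}

theorem Gen.one : Gen S 1 := ⟨1, one_mem _, rfl⟩

theorem Gen.mul (hA : Gen S A) (hB : Gen S B) : Gen S (A * B) := by
  obtain ⟨g, hg, rfl⟩ := hA
  obtain ⟨h, hh, rfl⟩ := hB
  exact ⟨g * h, mul_mem hg hh, rfl⟩

theorem Gen.of_mul_eq_one (hA : Gen S A) (h : A * B = 1) : Gen S B := by
  obtain ⟨g, hg, rfl⟩ := hA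
  exact ⟨g⁻¹, inv_mem hg, Units.inv_eq_of_mul_eq_one_right h⟩

theorem Gen.of_mem (hA : A ∈ S)
    (h : ∃ g ∈ loopUpq p q, (g : Matrix (Idx p q) (Idx p q) K) = A) : Gen S A := by
  obtain ⟨g, -, rfl⟩ := h
  exact ⟨g, Subgroup.subset_closure hA, rfl⟩

/-! ### Semisimple elements from the loops of type (2). -/

section torus

variable {k l : Idx p q}

/-- The semisimple element attached to the hyperbolic pair `e_k ± e_l`. -/
noncomputable def hypTorus (k l : Idx p q) (a : K) : Matrix (Idx p q) (Idx p q) K :=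
  torus (constVec (twoVec k l 1)) (constVec (twoVec k l (-1))) (RatFunc.C (sgn ℂ k / 2)) a

/-- For `L` spanned by `v`, the line `sL` is spanned by `u`, so the projections are explicit
combinations of `1`, `outerC v u` and `outerC u v`. -/
theorem gen_hypTorus_frac (hq : qLoops p q ⊆ S) (h : sgn ℂ k = -sgn ℂ l) (α β : ℂ) :
    Gen S (hypTorus k l (frac α β)) := by
  set v : Vec p q := twoVec k l 1 with hv
  set u : Vec p q := twoVec k l (-1) with hu
  -- The inverse of `form u v`, which is twice the sign of `k`.
  set c : ℂ := sgn ℂ k / 2 with hc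
  have hvv : form v v = 0 := by rw [form_twoVec_twoVec h]; simp
  have huu : form u u = 0 := by rw [form_twoVec_twoVec h]; simp
  have hvu : c * form v u = 1 := by
    rw [form_twoVec_twoVec h, map_one]; linear_combination sgn_mul_self (R := ℂ) k
  have huv : c * form u v = 1 := by
    rw [form_twoVec_twoVec h, map_neg, map_one]; linear_combination sgn_mul_self (R := ℂ) k
  set L := ℂ ∙ v with hL
  have hsL : sImage L = ℂ ∙ u := sImage_span_twoVec h
  have e1 : ∀ x, (c • outerC v u) *ᵥ x = (c * form u x) • v := fun x => by
    rw [Matrix.smul_mulVec, outerC_mulVec, smul_smul]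
  have e3 : ∀ x, (c • outerC u v) *ᵥ x = (c * form v x) • u := fun x => by
    rw [Matrix.smul_mulVec, outerC_mulVec, smul_smul]
  have e2 : ∀ x, (1 - c • outerC v u - c • outerC u v) *ᵥ x =
      x - (c * form u x) • v - (c * form v x) • u := fun x => by
    rw [Matrix.sub_mulVec, Matrix.sub_mulVec, e1, e3, Matrix.one_mulVec]
  have o : ∀ x, x - (c * form u x) • v - (c * form v x) • u ∈ orth (L ⊔ sImage L) := by
    intro x
    rw [hsL, mem_orth_span_pair]
    constructor
    · rw [sub_eq_add_neg, sub_eq_add_neg, ← neg_smul, ← neg_smul, form_add_right, form_add_right,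
        form_smul_right, form_smul_right, hvv]
      linear_combination -form v x * hvu
    · rw [sub_eq_add_neg, sub_eq_add_neg, ← neg_smul, ← neg_smul, form_add_right, form_add_right,
        form_smul_right, form_smul_right, huu]
      linear_combination -form u x * huv
  have mL : ∀ t : ℂ, t • v ∈ L := fun t => Submodule.smul_mem _ _ (Submodule.mem_span_singleton_self v)
  have msL : ∀ t : ℂ, t • u ∈ sImage L := fun t => by
    rw [hsL]; exact Submodule.smul_mem _ _ (Submodule.mem_span_singleton_self u)
  have v0 : ∀ x ∈ L, ∃ t : ℂ, x = t • v := fun x hx => by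
    obtain ⟨t, rfl⟩ := Submodule.mem_span_singleton.mp hx
    exact ⟨t, rfl⟩
  have u0 : ∀ x ∈ sImage L, ∃ t : ℂ, x = t • u := fun x hx => by
    rw [hsL] at hx
    obtain ⟨t, rfl⟩ := Submodule.mem_span_singleton.mp hx
    exact ⟨t, rfl⟩
  have z0 : ∀ x ∈ orth (L ⊔ sImage L), form v x = 0 ∧ form u x = 0 := fun x hx => by
    rwa [hsL, mem_orth_span_pair] at hx
  obtain ⟨h₁, p₁⟩ : ∃ h₁ : IsCompl L (orth (L ⊔ sImage L) ⊔ sImage L),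
      projC _ _ h₁ = c • outerC v u := by
    refine exists_projC_eq (fun x => ?_) (fun x => ?_) (fun x hx => ?_) (fun x hx => ?_)
    · rw [e1]; exact mL _
    · rw [e1]
      exact Submodule.mem_sup.mpr ⟨_, o x, _, msL (c * form v x), by abel⟩
    · obtain ⟨t, rfl⟩ := v0 x hx
      rw [e1, form_smul_right, mul_left_comm, huv, mul_one]
    · obtain ⟨a, ha, b, hb, rfl⟩ := Submodule.mem_sup.mp hx
      obtain ⟨t, rfl⟩ := u0 b hb
      rw [e1, form_add_right, (z0 a ha).2, form_smul_right, huu]; simp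
  obtain ⟨h₃, p₃⟩ : ∃ h₃ : IsCompl (sImage L) (L ⊔ orth (L ⊔ sImage L)),
      projC _ _ h₃ = c • outerC u v := by
    refine exists_projC_eq (fun x => ?_) (fun x => ?_) (fun x hx => ?_) (fun x hx => ?_)
    · rw [e3]; exact msL _
    · rw [e3]
      exact Submodule.mem_sup.mpr ⟨_, mL (c * form u x), _, o x, by abel⟩
    · obtain ⟨t, rfl⟩ := u0 x hx
      rw [e3, form_smul_right, mul_left_comm, hvu, mul_one]
    · obtain ⟨b, hb, a, ha, rfl⟩ := Submodule.mem_sup.mp hx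
      obtain ⟨t, rfl⟩ := v0 b hb
      rw [e3, form_add_right, (z0 a ha).1, form_smul_right, hvv]; simp
  obtain ⟨h₂, p₂⟩ : ∃ h₂ : IsCompl (orth (L ⊔ sImage L)) (L ⊔ sImage L),
      projC _ _ h₂ = 1 - c • outerC v u - c • outerC u v := by
    refine exists_projC_eq (fun x => ?_) (fun x => ?_) (fun x hx => ?_) (fun x hx => ?_)
    · rw [e2]; exact o x
    · rw [e2]
      exact Submodule.mem_sup.mpr ⟨_, mL (c * form u x), _, msL (c * form v x), by abel⟩
    · rw [e2, (z0 x hx).1, (z0 x hx).2]; simp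
    · obtain ⟨a, ha, b, hb, rfl⟩ := Submodule.mem_sup.mp hx
      obtain ⟨t, rfl⟩ := v0 a ha
      obtain ⟨t', rfl⟩ := u0 b hb
      rw [e2, form_add_right, form_add_right, form_smul_right, form_smul_right, form_smul_right,
        form_smul_right, hvv, huu, mul_zero, mul_zero, zero_add, add_zero, mul_left_comm, huv,
        mul_left_comm, hvu, mul_one, mul_one]
      abel
  have hmem : qLoop α β L h₁ h₂ h₃ ∈ qLoops p q :=
    ⟨α, β, L, h₁, h₂, h₃, finrank_span_singleton (twoVec_ne_zero (ne_of_sgn h) 1),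
      isIsotropic_span hvv, rfl⟩
  have eq : qLoop α β L h₁ h₂ h₃ = frac α β • const (projC _ _ h₁) + const (projC _ _ h₂) +
    frac ((starRingEnd ℂ) β) ((starRingEnd ℂ) α) • const (projC _ _ h₃) := rfl
  have hinv : (conjRat (frac α β))⁻¹ = frac ((starRingEnd ℂ) β) ((starRingEnd ℂ) α) := by
    rw [conjRat_frac]; exact inv_eq_of_mul_eq_one_right (frac_mul_frac _ _)
  have hg := Gen.of_mem (hq hmem) (exists_mem_loopUpq_of_mem_qLoops hmem)
  convert hg using 1
  rw [eq, p₁, p₂, p₃, hypTorus, torus, hinv, sub_eq_add_neg (1 - c • outerC v u),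
    sub_eq_add_neg 1, const_add, const_add, const_neg, const_neg, const_smul, const_smul,
    const_outerC, const_outerC, const_one]
  ext i j
  simp only [Matrix.add_apply, Matrix.neg_apply, Matrix.smul_apply, smul_eq_mul]
  ring

theorem pair_hyp (h : sgn ℂ k = -sgn ℂ l) :
    pair (constVec (twoVec k l 1)) (constVec (twoVec k l 1)) = 0 ∧
    pair (constVec (twoVec k l (-1))) (constVec (twoVec k l (-1))) = 0 ∧
    RatFunc.C (sgn ℂ k / 2) * pair (constVec (twoVec k l (-1))) (constVec (twoVec k l 1)) = 1 ∧
    RatFunc.C (sgn ℂ k / 2) * pair (constVec (twoVec k l 1)) (constVec (twoVec k l (-1))) = 1 := by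
  simp only [pair_constVec, form_twoVec_twoVec h, ← map_mul, map_one, map_neg]
  have e : sgn ℂ k / 2 * (sgn ℂ k * 2) = 1 := by linear_combination sgn_mul_self (R := ℂ) k
  refine ⟨by simp, by simp, ?_, ?_⟩ <;> norm_num [e]

theorem gen_hypTorus (hq : qLoops p q ⊆ S) (h : sgn ℂ k = -sgn ℂ l) {a : K}
    (ha : HasValueAtInfty a 1) : Gen S (hypTorus k l a) := by
  obtain ⟨h1, h2, h3, h4⟩ := pair_hyp h
  refine ha.induction_frac (p := fun a => Gen S (hypTorus k l a)) ?_ fun α β f _ hf => ?_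
  · have : hypTorus k l 1 = 1 := by simp [hypTorus, torus]
    rw [this]; exact Gen.one
  · have := (gen_hypTorus_frac hq h α β).mul hf
    rwa [hypTorus, hypTorus, torus_mul_torus h1 h2 h3 h4] at this

/-- Conjugation by semisimple elements. -/
theorem Gen.unip_conj (hq : qLoops p q ⊆ S) (h : sgn ℂ k = -sgn ℂ l) {w : Idx p q → K} {r : K}
    (hg : Gen S (unip (constVec (twoVec k l 1)) w r))
    (hw : pair (constVec (twoVec k l 1)) w = 0) (hw' : pair (constVec (twoVec k l (-1))) w = 0)
    {a : K} (ha : HasValueAtInfty a 1) :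
    Gen S (unip (constVec (twoVec k l 1)) (conjRat a • w) (a * conjRat a * r)) := by
  obtain ⟨h1, h2, h3, h4⟩ := pair_hyp h
  have ha0 := ha.ne_zero one_ne_zero
  have e := torus_mul_unip h1 h3 h4 hw hw' ha0 r
  have hinv : hypTorus k l a * hypTorus k l a⁻¹ = 1 := by
    rw [hypTorus, hypTorus, torus_mul_torus h1 h2 h3 h4, mul_inv_cancel₀ ha0]
    simp [torus]
  have hi : HasValueAtInfty a⁻¹ 1 := by simpa using ha.inv one_ne_zero
  have := ((gen_hypTorus hq h ha).mul hg).mul (gen_hypTorus hq h hi)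
  rw [hypTorus, e, mul_assoc] at this
  rw [hypTorus, hypTorus] at hinv
  rwa [hypTorus, hinv, mul_one] at this

end torus

end

section

variable {p q : ℕ} {S : Set (Matrix (Idx p q) (Idx p q) K)} {k l : Idx p q}

/-! ### Unipotent elements in the generated subgroup -/

theorem outerC_ne_zero {x y : Vec p q} (hx : x ≠ 0) (hy : y ≠ 0) : outerC x y ≠ 0 := by
  intro h
  apply hy
  refine eq_zero_of_form_eq_zero fun z => form_comm_eq_zero ?_
  have := outerC_mulVec x y z
  rw [h, Matrix.zero_mulVec] at this
  exact (smul_eq_zero.mp this.symm).resolve_right hx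

theorem rank_outerC {x y : Vec p q} (hx : x ≠ 0) (hy : y ≠ 0) : (outerC x y).rank = 1 := by
  refine le_antisymm (Matrix.rank_vecMulVec_le _ _) (Nat.one_le_iff_ne_zero.mpr fun h => ?_)
  rw [Matrix.rank, Submodule.finrank_eq_zero, LinearMap.range_eq_bot] at h
  refine outerC_ne_zero hx hy (Matrix.toLin'.injective ?_)
  rw [map_zero, ← h]
  rfl

theorem outerC_smul_left (c : ℂ) (x y : Vec p q) : outerC (c • x) y = c • outerC x y := by
  ext i j; simp [outerC, Matrix.vecMulVec_apply, mul_assoc]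

theorem constVec_smul (c : ℂ) (x : Vec p q) : constVec (c • x) = RatFunc.C c • constVec x := by
  ext i; simp [constVec]

theorem constVec_add (x y : Vec p q) : constVec (x + y) = constVec x + constVec y := by
  ext i; simp [constVec]

theorem constVec_zero : constVec (0 : Vec p q) = 0 := by
  ext i; simp [constVec]

/-- A type (3) loop with pole at `0`: `outerC y y` is self-adjoint, so an imaginary factor makes it
skew, and isotropy of `y` makes its square vanish. The degenerate cases are separate because the
loop needs rank one. -/
theorem gen_transvection (hm : mLoops p q ⊆ S) {y : Vec p q} (hy : form y y = 0) (t : ℝ) :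
    Gen S (1 + (RatFunc.C (Complex.I * t) * (RatFunc.X⁻¹ : K)) • outer (constVec y) (constVec y)) := by
  by_cases hy0 : y = 0
  · subst hy0
    have : outer (constVec (0 : Vec p q)) (constVec (0 : Vec p q)) = 0 := by
      rw [constVec_zero, ← zero_smul K (0 : Idx p q → K), outer_smul_left, zero_smul]
    rw [this, smul_zero, add_zero]; exact Gen.one
  by_cases ht : t = 0
  · subst ht; simpa using Gen.one
  have hIt : Complex.I * (t : ℂ) ≠ 0 := by simpa using ht
  have hmem : mLoop 0 1 ((Complex.I * (t : ℂ)) • outerC y y) ∈ mLoops p q := by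
    refine ⟨0, 1, _, Or.inl rfl, ?_, ?_, ?_, rfl⟩
    · rw [sq, smul_mul_smul_comm, outerC_mul_outerC, hy, zero_smul, smul_zero]
    · refine adjoint_eq_of_form fun u v => ?_
      rw [← neg_smul, Matrix.smul_mulVec, Matrix.smul_mulVec, form_smul_left, form_smul_right,
        form_adjoint, adjoint_outerC]
      simp
    · rw [← outerC_smul_left]
      exact rank_outerC (smul_ne_zero hIt hy0) hy0
  have hg := Gen.of_mem (hm hmem) (exists_mem_loopUpq_of_mem_mLoops hmem)
  convert hg using 2
  rw [mLoop, const_smul, const_outerC, smul_smul, pow_one, mul_comm]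
  simp

theorem conjRat_X_inv : conjRat ((RatFunc.X⁻¹ : K)) = (RatFunc.X⁻¹ : K) := by simp

theorem hasValueAtInfty_X_inv : HasValueAtInfty ((RatFunc.X⁻¹ : K)) 0 := by
  simpa using hasValueAtInfty_one_div_X_sub_C 0

theorem hasValueAtInfty_pair {x y : Idx p q → K} {a b : Vec p q}
    (hx : ∀ i, HasValueAtInfty (x i) (a i)) (hy : ∀ i, HasValueAtInfty (y i) (b i)) :
    HasValueAtInfty (pair x y) (form a b) := by
  rw [form_eq_sum]
  refine HasValueAtInfty.sum _ fun i _ => ((?_ : HasValueAtInfty _ _).mul (hx i).conj).mul (hy i)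
  rw [← C_sgn]
  exact hasValueAtInfty_C _

theorem HasValueAtInfty.half {f : K} {a : ℂ} (hf : HasValueAtInfty f a) :
    HasValueAtInfty (f / 2) (a / 2) := by
  have := hf.mul (hasValueAtInfty_C (2⁻¹ : ℂ))
  rwa [map_inv₀, map_ofNat, ← div_eq_mul_inv, ← div_eq_mul_inv] at this

/-- The correction in the Heisenberg law is skew, so a central unipotent can absorb it. -/
theorem conjRat_commutator (w w' : Idx p q → K) :
    conjRat ((pair w' w - pair w w') / 2) = -((pair w' w - pair w w') / 2) := by
  simp only [map_div₀, map_sub, conjRat_pair, map_ofNat]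
  ring

theorem hasValueAtInfty_commutator {w w' : Idx p q → K} (hw : ∀ i, HasValueAtInfty (w i) 0)
    (hw' : ∀ i, HasValueAtInfty (w' i) 0) :
    HasValueAtInfty ((pair w' w - pair w w') / 2) 0 := by
  have h1 := hasValueAtInfty_pair (a := 0) (b := 0) hw' hw
  have h2 := hasValueAtInfty_pair (a := 0) (b := 0) hw hw'
  have h0 : form (0 : Vec p q) 0 = 0 := by simp [form]
  rw [h0] at h1 h2
  simpa using (h1.sub h2).half

theorem hasValueAtInfty_X_inv_smul (x : Vec p q) (i : Idx p q) :
    HasValueAtInfty (((RatFunc.X⁻¹ : K) • constVec x) i) 0 := by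
  simpa [constVec] using hasValueAtInfty_X_inv.mul (hasValueAtInfty_C (x i))

/-- `unip v (X⁻¹ w) 0` for orthogonal isotropic constant vectors. -/
theorem gen_unip_of_isotropic (hm : mLoops p q ⊆ S) {v w : Vec p q} (hv : form v v = 0)
    (hw : form w w = 0) (hvw : form v w = 0) :
    Gen S (unip (constVec v) ((RatFunc.X⁻¹ : K) • constVec w) 0) := by
  have hwv := form_comm_eq_zero hvw
  have h1 : form (v + Complex.I • w) (v + Complex.I • w) = 0 := by
    simp [form_add_left, form_add_right, form_smul_left, form_smul_right, hv, hw, hvw, hwv]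
  -- Polarization: `i` times the outer square of `v + i w` is `outer v w - outer w v` plus `i` times
  -- the outer squares of `v` and `w`, which the other two factors remove.
  have g := ((gen_transvection hm h1 1).mul (gen_transvection hm hv (-1))).mul
    (gen_transvection hm hw (-1))
  convert g using 1
  have hI : RatFunc.C Complex.I * RatFunc.C Complex.I = -1 := by
    rw [← map_mul, Complex.I_mul_I, map_neg, map_one]
  simp only [unip, mul_add, add_mul, one_mul, mul_one, Matrix.smul_mul, Matrix.mul_smul,
    constVec_add, constVec_smul, outer_add_left, outer_add_right, outer_smul_left,
    outer_smul_right, outer_mul_outer, pair_constVec, hv, hw, hvw, hwv, map_zero, zero_smul,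
    smul_zero, pair_smul_left, pair_smul_right, conjRat_X_inv, conjRat_C, mul_zero, zero_mul, zero_smul]
  ext i j
  simp only [Matrix.add_apply, Matrix.sub_apply, Matrix.smul_apply, smul_eq_mul, Matrix.zero_apply,
    Complex.ofReal_one, Complex.ofReal_neg, Complex.conj_I, map_neg, map_one, mul_neg, map_mul]
  linear_combination ((RatFunc.X⁻¹ : K) * outer (constVec v) (constVec w) i j -
    (RatFunc.X⁻¹ : K) * outer (constVec w) (constVec v) i j +
    (RatFunc.X⁻¹ : K) * RatFunc.C Complex.I * outer (constVec w) (constVec w) i j) * hI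

/-- The range is spanned by `v` and `w`: the first is reached from `w`, the second from the test
vector `s`. -/
theorem outerC_sub_rank {v w s : Vec p q} (hvw : form v w = 0) (hws : form w s = 0)
    (hw : form w w ≠ 0) (hs : form v s ≠ 0) :
    (outerC v w - outerC w v).rank = 2 := by
  have e : ∀ x, (outerC v w - outerC w v) *ᵥ x = form w x • v - form v x • w := fun x => by
    rw [Matrix.sub_mulVec, outerC_mulVec, outerC_mulVec]
  have hli : LinearIndependent ℂ ![v, w] := by
    rw [LinearIndependent.pair_iff]
    intro a b hab
    have hb : b = 0 := by
      have := congrArg (form w) hab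
      rw [form_add_right, form_smul_right, form_smul_right, form_comm_eq_zero hvw, mul_zero,
        zero_add] at this
      have h0 : form w 0 = 0 := by simp [form]
      rw [h0] at this
      exact (mul_eq_zero.mp this).resolve_right hw
    subst hb
    refine ⟨?_, rfl⟩
    rw [zero_smul, add_zero] at hab
    refine (smul_eq_zero.mp hab).resolve_right fun h => hs ?_
    rw [h]; simp [form]
  have hr : LinearMap.range (outerC v w - outerC w v).mulVecLin =
      Submodule.span ℂ (Set.range ![v, w]) := by
    rw [Matrix.range_cons, Matrix.range_cons, Matrix.range_empty, Set.union_empty]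
    apply le_antisymm
    · rintro _ ⟨x, rfl⟩
      rw [Matrix.mulVecLin_apply, e]
      exact sub_mem (Submodule.smul_mem _ _ (Submodule.subset_span (by simp)))
        (Submodule.smul_mem _ _ (Submodule.subset_span (by simp)))
    · rw [Submodule.span_le]
      rintro x (hx | hx) <;> rw [Set.mem_singleton_iff] at hx <;> subst hx
      · refine ⟨(form w w)⁻¹ • w, ?_⟩
        rw [Matrix.mulVecLin_apply, e, form_smul_right, form_smul_right, hvw,
          inv_mul_cancel₀ hw]
        simp
      · refine ⟨-(form v s)⁻¹ • s, ?_⟩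
        rw [Matrix.mulVecLin_apply, e, form_smul_right, form_smul_right, hws, neg_mul,
          neg_mul, inv_mul_cancel₀ hs]
        simp
  rw [Matrix.rank, hr, finrank_span_eq_card hli]
  simp

/-- `unip v (X⁻¹ w) 0` from the loops attached to a one-dimensional maximal isotropic subspace. -/
theorem gen_unip_of_maximal (hn : nLoops p q ⊆ S) {v w u : Vec p q}
    (hV : Maximal IsIsotropic (ℂ ∙ v)) (hsV : sImage (ℂ ∙ v) = ℂ ∙ u) (hvw : form v w = 0)
    (hwu : form w u = 0) (hw : form w w ≠ 0) (hvu : form v u ≠ 0) :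
    Gen S (unip (constVec v) ((RatFunc.X⁻¹ : K) • constVec w) 0) := by
  have hv0 : v ≠ 0 := by rintro rfl; apply hvu; simp [form]
  have hw0 : w ≠ 0 := by rintro rfl; apply hw; simp [form]
  have hvv : form v v = 0 := hV.prop v (Submodule.mem_span_singleton_self v) v
    (Submodule.mem_span_singleton_self v)
  have hwv := form_comm_eq_zero hvw
  have hmem : nLoop 0 1 (outerC v w - outerC w v) ∈ nLoops p q := by
    refine ⟨0, ℂ ∙ v, outerC v w, _, hV, fun x hx => ?_, fun x => ?_, ?_, rank_outerC hv0 hw0,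
      outerC_sub_rank hvw hwu hw hvu, rfl⟩
    · obtain ⟨a, ha, b, hb, rfl⟩ := Submodule.mem_sup.mp hx
      obtain ⟨t, rfl⟩ := Submodule.mem_span_singleton.mp ha
      rw [hsV] at hb
      obtain ⟨t', rfl⟩ := Submodule.mem_span_singleton.mp hb
      rw [outerC_mulVec, form_add_right, form_smul_right, form_smul_right, hwv, hwu]
      simp
    · rw [outerC_mulVec]
      exact Submodule.smul_mem _ _ (Submodule.mem_span_singleton_self v)
    · rw [adjoint_outerC]
  have hg := Gen.of_mem (hn hmem) (exists_mem_loopUpq_of_mem_nLoops hmem)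
  convert hg using 1
  -- Half of this is the quadratic term built into `unip`, so the loop is that unipotent with
  -- central parameter `0`.
  have hNN : (outerC v w - outerC w v) ^ 2 = (-form w w) • outerC v v := by
    rw [sq, sub_mul, mul_sub, mul_sub, outerC_mul_outerC, outerC_mul_outerC, outerC_mul_outerC,
      outerC_mul_outerC, hwv, hvv, hvw]
    simp
  rw [nLoop, hNN, sub_eq_add_neg (outerC v w), const_add, const_neg, const_smul, const_outerC, const_outerC,
    const_outerC, unip]
  simp only [Complex.ofReal_zero, map_zero, sub_zero, pow_one, one_div, outer_smul_left,
    outer_smul_right, conjRat_X_inv, pair_smul_left, pair_smul_right, pair_constVec]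
  ext i j
  simp only [Matrix.add_apply, Matrix.sub_apply, Matrix.neg_apply, Matrix.smul_apply, smul_eq_mul,
    map_neg, map_inv₀, map_ofNat]
  ring

/-- `unip v (X⁻¹ c e_i) 0` for `v = e_k + e_l`. -/
theorem gen_unip_single_X_inv (hpq : p ≤ q) (hm : mLoops p q ⊆ S) (hn : p ≠ q → nLoops p q ⊆ S)
    (h : sgn ℂ k = -sgn ℂ l) {i : Idx p q} (hik : i ≠ k) (hil : i ≠ l) {c : ℂ} (hc : c ≠ 0) :
    ∃ r, conjRat r = -r ∧ HasValueAtInfty r 0 ∧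
      Gen S (unip (constVec (twoVec k l 1)) ((RatFunc.X⁻¹ : K) • constVec (Pi.single i c)) r) := by
  have hvv : form (twoVec k l 1) (twoVec k l 1) = 0 := by rw [form_twoVec_twoVec h]; simp
  have hv1 : ∀ j, j ≠ k → j ≠ l → ∀ d, form (twoVec k l 1) (Pi.single j d) = 0 :=
    fun j hjk hjl d => by
      rw [form_single_right, twoVec_apply_of_ne hjk hjl]; simp
  -- With a spare `j` of opposite sign, `c e_i` is the sum of the isotropic vectors `(c/2)(e_i ±
  -- e_j)`; multiplying their unipotents leaves a skew central parameter.
  by_cases hj : ∃ j, j ≠ k ∧ j ≠ l ∧ sgn ℂ i = -sgn ℂ j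
  · obtain ⟨j, hjk, hjl, hij⟩ := hj
    have hw : ∀ ε : ℂ, ε = 1 ∨ ε = -1 → form (twoVec k l 1) ((c / 2) • twoVec i j ε) = 0 ∧
        form ((c / 2) • twoVec i j ε) ((c / 2) • twoVec i j ε) = 0 := by
      intro ε hε
      constructor
      · rw [form_smul_right, twoVec.eq_def i, form_add_right, hv1 i hik hil, hv1 j hjk hjl]; simp
      · rw [form_smul_left, form_smul_right, form_twoVec_twoVec hij]
        rcases hε with rfl | rfl <;> simp
    have g1 := gen_unip_of_isotropic hm hvv (hw 1 (Or.inl rfl)).2 (hw 1 (Or.inl rfl)).1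
    have g2 := gen_unip_of_isotropic hm hvv (hw (-1) (Or.inr rfl)).2 (hw (-1) (Or.inr rfl)).1
    have g := g1.mul g2
    have hp : ∀ ε : ℂ, ε = 1 ∨ ε = -1 → pair (constVec (twoVec k l 1))
        ((RatFunc.X⁻¹ : K) • constVec ((c / 2) • twoVec i j ε)) = 0 := fun ε hε => by
      rw [pair_smul_right, pair_constVec, (hw ε hε).1, map_zero, mul_zero]
    rw [unip_mul_unip (by rw [pair_constVec, hvv, map_zero]) (hp 1 (Or.inl rfl))
      (hp (-1) (Or.inr rfl)), ← smul_add, ← constVec_add, ← smul_add] at g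
    have hs : (c / 2) • (twoVec i j 1 + twoVec i j (-1)) = Pi.single i c := by
      have : twoVec i j 1 + twoVec i j (-1) = (2 : ℂ) • Pi.single i 1 := by
        rw [twoVec, twoVec, Pi.single_neg, two_smul]; abel
      rw [this, smul_smul, ← Pi.single_smul]; simp
    rw [hs] at g
    rw [zero_add, zero_add] at g
    exact ⟨_, conjRat_commutator _ _, hasValueAtInfty_commutator
      (hasValueAtInfty_X_inv_smul _) (hasValueAtInfty_X_inv_smul _), g⟩
  -- Now every coordinate besides `k`, `l` has the sign of `i`. As `p ≤ q`, this forces `p = 1 < q`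
  -- and a positive `i`.
  · push Not at hj
    refine ⟨0, by simp, hasValueAtInfty_zero, ?_⟩
    have hkl := ne_of_sgn h
    -- The pair may come in either order; `a` is its negative member and `b` its positive one.
    obtain ⟨a, b, hab⟩ : ∃ a b, ∀ j, j ≠ k ∧ j ≠ l ↔ j ≠ Sum.inl a ∧ j ≠ Sum.inr b := by
      rcases k with a | a <;> rcases l with b | b
      · norm_num [sgn] at h
      · exact ⟨a, b, fun j => Iff.rfl⟩
      · exact ⟨b, a, fun j => and_comm⟩
      · norm_num [sgn] at h
    have hi := (hab i).mp ⟨hik, hil⟩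
    obtain ⟨i', rfl⟩ : ∃ i', i = Sum.inr i' := by
      rcases i with i | i
      · exfalso
        have hq1 : q ≤ 1 := Fin.subsingleton_iff_le_one.mp <| subsingleton_of_forall_eq b fun b' => by
          by_contra hb
          obtain ⟨h1, h2⟩ := (hab (Sum.inr b')).mpr ⟨by simp, by simpa using hb⟩
          exact hj _ h1 h2 (by simp [sgn])
        have hp2 : 2 ≤ p := Fin.nontrivial_iff_two_le.mp ⟨i, a, by simpa using hi.1⟩
        omega
      · exact ⟨i, rfl⟩
    have ha : ∀ a', a' = a := fun a' => by
      by_contra ha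
      obtain ⟨h1, h2⟩ := (hab (Sum.inl a')).mpr ⟨by simpa using ha, by simp⟩
      exact hj _ h1 h2 (by simp [sgn])
    have hp1 : p ≤ 1 := Fin.subsingleton_iff_le_one.mp (subsingleton_of_forall_eq a ha)
    have hq2 : 2 ≤ q := Fin.nontrivial_iff_two_le.mp ⟨i', b, by simpa using hi.2⟩
    have hpne : p ≠ q := by omega
    have hV : Maximal IsIsotropic (ℂ ∙ twoVec k l 1) := by
      refine ⟨isIsotropic_span hvv, fun W hW hle y hy => ?_⟩
      have hvW : twoVec k l 1 ∈ W := hle (Submodule.mem_span_singleton_self _)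
      have hyv := hW _ hvW y hy
      rw [form_twoVec_left, h, map_one, mul_one, neg_mul, neg_add_eq_zero] at hyv
      have hykl : y k = y l := mul_left_cancel₀ (sgn_ne_zero l) hyv
      -- Removing the `v`-part leaves an isotropic vector without negative coordinates, hence zero.
      set z := y - y k • twoVec k l 1 with hz
      have hzk : z k = 0 := by simp [hz, twoVec_apply_left hkl]
      have hzl : z l = 0 := by simp [hz, twoVec_apply_right hkl, hykl]
      have hzW : z ∈ W := sub_mem hy (W.smul_mem _ hvW)
      have hzl : ∀ a', z (Sum.inl a') = 0 := fun a' => by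
        rw [ha a']
        by_contra h0
        exact ((hab (Sum.inl a)).mp ⟨fun e => h0 (e ▸ hzk), fun e => h0 (e ▸ hzl)⟩).1 rfl
      have hzz := hW z hzW z hzW
      have e : form z z = star z ⬝ᵥ z := by
        simp [form, dotProduct, Fintype.sum_sum_type, hzl]
      rw [e] at hzz
      have hz0 : z = 0 := by
        open scoped ComplexOrder in exact dotProduct_star_self_eq_zero.mp hzz
      rw [hz, sub_eq_zero] at hz0
      rw [hz0]
      exact Submodule.smul_mem _ _ (Submodule.mem_span_singleton_self _)
    refine gen_unip_of_maximal (hn hpne) hV (sImage_span_twoVec h) (hv1 _ hik hil c) ?_ ?_ ?_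
    · apply form_comm_eq_zero
      rw [form_single_right, twoVec_apply_of_ne hik hil]; simp
    · rw [form_single_left]; simp [hc, sgn]
    · rw [form_twoVec_twoVec h]; simp [sgn_ne_zero]

end

/-! ### All unipotent elements attached to a hyperbolic pair. -/

section

variable {p q : ℕ} {S : Set (Matrix (Idx p q) (Idx p q) K)} {k l : Idx p q}

theorem unip_zero (v : Idx p q → K) (r : K) : unip v 0 r = 1 + r • outer v v := by
  have h1 : outer v 0 = 0 := by rw [← zero_smul K (0 : Idx p q → K), outer_smul_right]; simp
  have h2 : outer 0 v = 0 := by rw [← zero_smul K (0 : Idx p q → K), outer_smul_left]; simp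
  rw [unip, h1, h2]
  simp

theorem pair_twoVec_left (k l : Idx p q) (ε : ℂ) (w : Idx p q → K) :
    pair (constVec (twoVec k l ε)) w =
      sgn K k * w k + sgn K l * RatFunc.C ((starRingEnd ℂ) ε) * w l := by
  have : constVec (twoVec k l ε) = Pi.single k 1 + Pi.single l (RatFunc.C ε) := by
    ext i
    simp only [constVec, twoVec, Pi.add_apply, map_add, Pi.single_apply]
    split_ifs <;> simp
  rw [this, pair_add_left, pair_single_left, pair_single_left]
  simp

/-- The central unipotent elements. -/
theorem gen_unip_zero (hq : qLoops p q ⊆ S) (hm : mLoops p q ⊆ S) (h : sgn ℂ k = -sgn ℂ l)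
    {r : K} (hr : conjRat r = -r) (hr0 : HasValueAtInfty r 0) :
    Gen S (unip (constVec (twoVec k l 1)) 0 r) := by
  obtain ⟨h1, -, -, -⟩ := pair_hyp h
  have hvv : form (twoVec k l 1) (twoVec k l 1) = 0 := by rw [form_twoVec_twoVec h]; simp
  -- Conjugating a transvection by a torus element with real parameter multiplies its central
  -- parameter by a square.
  have base : ∀ t : ℝ, ∀ a : K, HasValueAtInfty a 1 → conjRat a = a →
      Gen S (unip (constVec (twoVec k l 1)) 0
        (a * a * (RatFunc.C (Complex.I * t) * (RatFunc.X⁻¹ : K)))) := by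
    intro t a ha haa
    have := gen_transvection hm hvv t
    rw [← unip_zero] at this
    have := this.unip_conj hq h (pair_zero_right _) (pair_zero_right _) ha
    rwa [smul_zero, haa] at this
  obtain ⟨d, hd⟩ := hr0.exists_X_mul
  have hdd : (starRingEnd ℂ) d = -d := by
    refine hd.conj.unique ?_
    rw [map_mul, conjRat_X, hr, mul_neg]
    exact hd.neg
  -- Then `r = i F / X`, where `F` is fixed by conjugation and has a real value at infinity.
  set F : K := RatFunc.C (-Complex.I) * (RatFunc.X * r) with hF
  have hFe : HasValueAtInfty F (d.im : ℂ) := by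
    have hde : -Complex.I * d = (d.im : ℂ) := by
      have hre : d.re = 0 := by
        have := congrArg Complex.re hdd
        simp at this
        linarith
      apply Complex.ext <;> simp [hre]
    rw [← hde]
    exact hd.const_mul _
  have hFF : conjRat F = F := by
    simp [hF, hr]
  set e : ℝ := d.im with he
  -- The identity used is `4 m F = (F + m)² - (F - m)²`. This `m` keeps both `e + m` and `e - m`
  -- nonzero, so the two bases can be normalized to value `1` at infinity.
  set m : ℝ := |e| + 1 with hmdef
  have hm0 : m ≠ 0 := by positivity
  have hem : e + m ≠ 0 := by
    have := neg_abs_le e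
    intro h0; linarith
  have hem' : e - m ≠ 0 := by
    have := le_abs_self e
    intro h0; linarith
  have val : ∀ n : ℝ, e + n ≠ 0 →
      HasValueAtInfty ((F + RatFunc.C (n : ℂ)) * RatFunc.C ((e + n : ℝ) : ℂ)⁻¹) 1 ∧
      conjRat ((F + RatFunc.C (n : ℂ)) * RatFunc.C ((e + n : ℝ) : ℂ)⁻¹) =
        (F + RatFunc.C (n : ℂ)) * RatFunc.C ((e + n : ℝ) : ℂ)⁻¹ := by
    intro n hn
    constructor
    · have := (hFe.add (hasValueAtInfty_C (n : ℂ))).mul (hasValueAtInfty_C ((e + n : ℝ) : ℂ)⁻¹)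
      rwa [← Complex.ofReal_add, mul_inv_cancel₀ (by exact_mod_cast hn)] at this
    · rw [map_mul, map_add, hFF, conjRat_C, conjRat_C, map_inv₀, Complex.conj_ofReal,
        Complex.conj_ofReal]
  obtain ⟨a1, a2⟩ := val m hem
  obtain ⟨b1, b2⟩ := val (-m) (by rwa [← sub_eq_add_neg])
  have g := (base ((e + m) ^ 2 / (4 * m)) _ a1 a2).mul (base (-(e + -m) ^ 2 / (4 * m)) _ b1 b2)
  rw [unip_mul_unip h1 (pair_zero_right _) (pair_zero_right _), add_zero] at g
  convert g using 2
  have hr' : r = RatFunc.C Complex.I * F * (RatFunc.X⁻¹ : K) := by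
    have hI : RatFunc.C Complex.I * RatFunc.C Complex.I = (-1 : K) := by
      rw [← map_mul, Complex.I_mul_I, map_neg, map_one]
    have hX : (RatFunc.X : K) * RatFunc.X⁻¹ = 1 := mul_inv_cancel₀ RatFunc.X_ne_zero
    rw [hF, map_neg]
    linear_combination r * RatFunc.X * (RatFunc.X⁻¹ : K) * hI - r * hX
  have hE : ∀ x : ℝ, x ≠ 0 → RatFunc.C (x : ℂ) ≠ (0 : K) := fun x hx => by simpa using hx
  have n1 := hE m hm0
  have n2 := hE _ hem
  have n3 := hE (e + -m) (by rwa [← sub_eq_add_neg])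
  rw [hr']
  push_cast at n2 n3 ⊢
  simp only [map_mul, map_div₀, map_add, map_neg, map_pow, map_inv₀, map_ofNat, pair_zero_right,
    sub_zero, zero_div, add_zero] at n2 n3 ⊢
  field_simp
  ring

/-- The central parameter of a unipotent element can be changed. -/
theorem Gen.unip_change (hq : qLoops p q ⊆ S) (hm : mLoops p q ⊆ S) (h : sgn ℂ k = -sgn ℂ l)
    {w : Idx p q → K} {r r' : K} (hg : Gen S (unip (constVec (twoVec k l 1)) w r))
    (hw : pair (constVec (twoVec k l 1)) w = 0) (hr : conjRat r = -r) (hr0 : HasValueAtInfty r 0)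
    (hr' : conjRat r' = -r') (hr0' : HasValueAtInfty r' 0) :
    Gen S (unip (constVec (twoVec k l 1)) w r') := by
  obtain ⟨h1, -, -, -⟩ := pair_hyp h
  have := hg.mul (gen_unip_zero hq hm h (r := r' - r) (by rw [map_sub, hr, hr']; ring)
    (by simpa using hr0'.sub hr0))
  rw [unip_mul_unip h1 hw (pair_zero_right _)] at this
  simpa using this

/-- Once central parameters are adjustable, the Heisenberg law becomes additive in the vector part.
-/
theorem Gen.unip_add (hq : qLoops p q ⊆ S) (hm : mLoops p q ⊆ S) (h : sgn ℂ k = -sgn ℂ l)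
    {w w' : Idx p q → K} (hg : Gen S (unip (constVec (twoVec k l 1)) w 0))
    (hg' : Gen S (unip (constVec (twoVec k l 1)) w' 0))
    (hw : pair (constVec (twoVec k l 1)) w = 0) (hw' : pair (constVec (twoVec k l 1)) w' = 0)
    (h0 : ∀ i, HasValueAtInfty (w i) 0) (h0' : ∀ i, HasValueAtInfty (w' i) 0) :
    Gen S (unip (constVec (twoVec k l 1)) (w + w') 0) := by
  obtain ⟨h1, -, -, -⟩ := pair_hyp h
  have := hg.mul hg'
  rw [unip_mul_unip h1 hw hw', zero_add, zero_add] at this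
  exact this.unip_change hq hm h (by rw [pair_add_right, hw, hw', add_zero])
    (conjRat_commutator _ _) (hasValueAtInfty_commutator h0 h0') (by simp) hasValueAtInfty_zero

theorem pair_twoVec_single {i : Idx p q} (hik : i ≠ k) (hil : i ≠ l) (ε : ℂ) (f : K) :
    pair (constVec (twoVec k l ε)) (Pi.single i f) = 0 := by
  rw [pair_twoVec_left, Pi.single_eq_of_ne hik.symm, Pi.single_eq_of_ne hil.symm]; simp

theorem hasValueAtInfty_single {i : Idx p q} {f : K} (hf : HasValueAtInfty f 0) (j : Idx p q) :
    HasValueAtInfty ((Pi.single i f : Idx p q → K) j) 0 := by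
  rw [Pi.single_apply]
  split_ifs
  exacts [hf, hasValueAtInfty_zero]

theorem gen_unip_single (hpq : p ≤ q) (hq : qLoops p q ⊆ S) (hm : mLoops p q ⊆ S)
    (hn : p ≠ q → nLoops p q ⊆ S) (h : sgn ℂ k = -sgn ℂ l) {i : Idx p q} (hik : i ≠ k)
    (hil : i ≠ l) {f : K} (hf : HasValueAtInfty f 0) :
    Gen S (unip (constVec (twoVec k l 1)) (Pi.single i f) 0) := by
  have key : ∀ (f : K) (c : ℂ), c ≠ 0 → HasValueAtInfty (RatFunc.X * f) c →
      Gen S (unip (constVec (twoVec k l 1)) (Pi.single i f) 0) := by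
    intro f c hc hf
    obtain ⟨r, hr, hr0, g⟩ := gen_unip_single_X_inv hpq hm hn h hik hil hc
    have e : (RatFunc.X⁻¹ : K) • constVec (Pi.single i c) =
        Pi.single i ((RatFunc.X⁻¹ : K) * RatFunc.C c) := by
      ext j
      simp only [constVec, Pi.smul_apply, smul_eq_mul, Pi.single_apply]
      split_ifs <;> simp
    rw [e] at g
    replace g := g.unip_change hq hm h (pair_twoVec_single hik hil _ _) hr hr0 (r' := 0) (by simp)
      hasValueAtInfty_zero
    -- Conjugation by the torus scales `w` by the conjugate of its parameter, so the desired ratio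
    -- `X f / c` enters conjugated.
    have ha : HasValueAtInfty (conjRat (RatFunc.X * f * RatFunc.C c⁻¹)) 1 := by
      have := (hf.mul (hasValueAtInfty_C c⁻¹)).conj
      rwa [mul_inv_cancel₀ hc, map_one] at this
    have g' := g.unip_conj hq h (pair_twoVec_single hik hil _ _) (pair_twoVec_single hik hil _ _) ha
    have hcK : RatFunc.C c ≠ (0 : K) := by simpa using hc
    have hX : (RatFunc.X : K) ≠ 0 := RatFunc.X_ne_zero
    rw [mul_zero, conjRat_conjRat, ← Pi.single_smul] at g'
    have e' : (RatFunc.X * f * RatFunc.C c⁻¹) • ((RatFunc.X⁻¹ : K) * RatFunc.C c) = f := by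
      rw [smul_eq_mul, map_inv₀]
      field_simp
    rwa [e'] at g'
  obtain ⟨c, hc⟩ := hf.exists_X_mul
  -- If `f` vanishes to higher order at infinity, it is split as `(f + X⁻¹) - X⁻¹`; both summands
  -- have a nonzero leading coefficient.
  by_cases hc0 : c = 0
  · subst hc0
    have hX : (RatFunc.X : K) * RatFunc.X⁻¹ = 1 := mul_inv_cancel₀ RatFunc.X_ne_zero
    have h1 : HasValueAtInfty (RatFunc.X * (f + (RatFunc.X⁻¹ : K))) 1 := by
      rw [mul_add, hX]; simpa using hc.add hasValueAtInfty_one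
    have h2 : HasValueAtInfty (RatFunc.X * (-(RatFunc.X⁻¹ : K))) (-1) := by
      rw [mul_neg, hX]; exact hasValueAtInfty_one.neg
    have g := (key _ _ one_ne_zero h1).unip_add hq hm h (key _ _ (by norm_num) h2)
      (pair_twoVec_single hik hil _ _) (pair_twoVec_single hik hil _ _)
      (hasValueAtInfty_single (by simpa using hf.add hasValueAtInfty_X_inv))
      (hasValueAtInfty_single (by simpa using hasValueAtInfty_X_inv.neg))
    rwa [← Pi.single_add, add_neg_cancel_right] at g
  · exact key f c hc0 hc

theorem gen_unip (hpq : p ≤ q) (hq : qLoops p q ⊆ S) (hm : mLoops p q ⊆ S)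
    (hn : p ≠ q → nLoops p q ⊆ S) (h : sgn ℂ k = -sgn ℂ l) {w : Idx p q → K}
    (hw : ∀ i, HasValueAtInfty (w i) 0) (hk : w k = 0) (hl : w l = 0) :
    Gen S (unip (constVec (twoVec k l 1)) w 0) := by
  have hs : ∀ s : Finset (Idx p q), (∀ i, HasValueAtInfty (s.piecewise w 0 i) 0) ∧
      pair (constVec (twoVec k l 1)) (s.piecewise w 0) = 0 := by
    intro s
    constructor
    · intro i
      by_cases hi : i ∈ s
      · rw [Finset.piecewise_eq_of_mem _ _ _ hi]; exact hw i
      · rw [Finset.piecewise_eq_of_notMem _ _ _ hi]; exact hasValueAtInfty_zero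
    · rw [pair_twoVec_left]
      simp [Finset.piecewise, hk, hl]
  have key : ∀ s : Finset (Idx p q),
      Gen S (unip (constVec (twoVec k l 1)) (s.piecewise w 0) 0) := by
    intro s
    induction s using Finset.induction_on with
    | empty =>
      rw [Finset.piecewise_empty]
      exact gen_unip_zero hq hm h (by simp) hasValueAtInfty_zero
    | insert i s hi ih =>
      have e : (insert i s).piecewise w 0 = Pi.single i (w i) + s.piecewise w 0 := by
        ext j
        by_cases hj : j = i
        · subst hj; simp [Finset.piecewise, hi]
        · simp [Finset.piecewise, hj]
      rw [e]
      by_cases hik : i = k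
      · rw [hik, hk, Pi.single_zero, zero_add]; exact ih
      by_cases hil : i = l
      · rw [hil, hl, Pi.single_zero, zero_add]; exact ih
      exact (gen_unip_single hpq hq hm hn h hik hil (hw i)).unip_add hq hm h ih
        (pair_twoVec_single hik hil _ _) (hs s).2 (hasValueAtInfty_single (hw i)) (hs s).1
  simpa using key Finset.univ

end

section

variable {p q : ℕ} {S : Set (Matrix (Idx p q) (Idx p q) K)} {k l : Idx p q}

/-! ### Gaussian elimination in `loopUpq` -/

theorem pair_loopAdjoint (A : Matrix (Idx p q) (Idx p q) K) (x y : Idx p q → K) :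
    pair (A *ᵥ x) y = pair x (loopAdjoint A *ᵥ y) := by
  have hs : ∀ i, Sum.elim (fun _ : Fin p => (-1 : K)) (fun _ : Fin q => 1) i = sgn K i :=
    fun i => rfl
  have e : ∀ i j, loopAdjoint A i j = sgn K i * conjRat (A j i) * sgn K j := fun i j => by
    simp [loopAdjoint, sigMatrix, Matrix.mul_diagonal, Matrix.diagonal_mul, hs]
  simp only [pair, Matrix.mulVec, dotProduct, e, map_sum, map_mul, Finset.mul_sum, Finset.sum_mul]
  rw [Finset.sum_comm]
  refine Finset.sum_congr rfl fun i _ => Finset.sum_congr rfl fun j _ => ?_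
  linear_combination -sgn K j * conjRat (A j i) * conjRat (x i) * y j * sgn_mul_self (R := K) i

theorem pair_mulVec_mulVec {g : GL (Idx p q) K} (hg : g ∈ loopUpq p q) (x y : Idx p q → K) :
    pair (g.val *ᵥ x) (g.val *ᵥ y) = pair x y := by
  rw [pair_loopAdjoint, Matrix.mulVec_mulVec, (isUpqReal_iff g).mp hg.2, Matrix.one_mulVec]

theorem hasValueAtInfty_sgn (k : Idx p q) : HasValueAtInfty (sgn K k) (sgn ℂ k) := by
  rw [← C_sgn]; exact hasValueAtInfty_C _

theorem unip_mulVec_single {w : Idx p q → K} {i : Idx p q} (hik : i ≠ k) (hil : i ≠ l)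
    (hi : w i = 0) (r : K) :
    unip (constVec (twoVec k l 1)) w r *ᵥ Pi.single i 1 = Pi.single i 1 := by
  rw [unip_mulVec, pair_single_right, hi, pair_twoVec_single hik hil]
  simp

theorem hypTorus_mulVec_single {i : Idx p q} (hik : i ≠ k) (hil : i ≠ l) (a : K) :
    hypTorus k l a *ᵥ Pi.single i 1 = Pi.single i 1 := by
  rw [hypTorus, torus_mulVec, pair_twoVec_single hik hil, pair_twoVec_single hik hil]
  simp

theorem constVec_twoVec_apply_left (h : k ≠ l) (ε : ℂ) : constVec (twoVec k l ε) k = 1 := by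
  simp [constVec, twoVec_apply_left h]

theorem constVec_twoVec_apply_right (h : k ≠ l) (ε : ℂ) :
    constVec (twoVec k l ε) l = RatFunc.C ε := by
  simp [constVec, twoVec_apply_right h]

theorem constVec_twoVec_apply_of_ne {i : Idx p q} (hik : i ≠ k) (hil : i ≠ l) (ε : ℂ) :
    constVec (twoVec k l ε) i = 0 := by
  simp [constVec, twoVec_apply_of_ne hik hil]

/-- A vector near `e_k` of the same norm can be moved to `e_k` by an element of the generated
subgroup that fixes the basis vectors orthogonal to it. -/
theorem exists_gen_mulVec_eq_single (hpq : p ≤ q) (hq : qLoops p q ⊆ S) (hm : mLoops p q ⊆ S)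
    (hn : p ≠ q → nLoops p q ⊆ S) (hS : ∀ A, Gen S A → loopAdjoint A * A = 1)
    (h : sgn ℂ k = -sgn ℂ l) {x : Idx p q → K}
    (hx : ∀ i, HasValueAtInfty (x i) ((1 : Matrix (Idx p q) (Idx p q) ℂ) i k))
    (hxx : pair x x = sgn K k) :
    ∃ A, Gen S A ∧ A *ᵥ x = Pi.single k 1 ∧
      ∀ i, i ≠ k → i ≠ l → x i = 0 → A *ᵥ Pi.single i 1 = Pi.single i 1 := by
  have hkl := ne_of_sgn h
  have hK : sgn K l = -sgn K k := by rw [← C_sgn, ← C_sgn, h, map_neg, neg_neg]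
  have hkk := sgn_mul_self (R := K) k
  have hpair : ∀ A, Gen S A → ∀ y, pair (A *ᵥ y) (A *ᵥ y) = pair y y := fun A hA y => by
    rw [pair_loopAdjoint, Matrix.mulVec_mulVec, hS A hA, Matrix.one_mulVec]
  set v := constVec (twoVec k l 1) with hv
  have hpv : ∀ y, pair v y = sgn K k * (y k - y l) := fun y => by
    rw [hv, pair_twoVec_left, hK, map_one, map_one]; ring
  have hpu : ∀ y, pair (constVec (twoVec k l (-1))) y = sgn K k * (y k + y l) := fun y => by
    rw [pair_twoVec_left, hK, map_neg, map_one, map_neg, map_one]; ring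
  -- The pivot: up to sign it is `pair v x`, and its value at infinity is `1`.
  set d := x k - x l with hd
  have hd1 : HasValueAtInfty d 1 := by
    have := (hx k).sub (hx l)
    rwa [Matrix.one_apply_eq, Matrix.one_apply_ne hkl.symm, sub_zero] at this
  have hd0 := hd1.ne_zero one_ne_zero
  have hdd : d⁻¹ * (x k - x l) = 1 := inv_mul_cancel₀ hd0
  set δ := sgn K k * d with hδ
  have hδ0 : δ ≠ 0 := mul_ne_zero (sgn_ne_zero k) hd0
  have hδv : HasValueAtInfty δ (sgn ℂ k) := by
    simpa using (hasValueAtInfty_sgn k).mul hd1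
  -- The unipotent subtracts `pair v x • w = δ • w`, which clears every coordinate outside `k`, `l`.
  set w : Idx p q → K := fun i => if i = k ∨ i = l then 0 else x i / δ with hw
  have hwk : w k = 0 := by simp [hw]
  have hwl : w l = 0 := by simp [hw]
  have hwi : ∀ i, i ≠ k → i ≠ l → w i = x i / δ := fun i h1 h2 => by simp [hw, h1, h2]
  have hw0 : ∀ i, HasValueAtInfty (w i) 0 := by
    intro i
    by_cases hik : i = k
    · rw [hik, hwk]; exact hasValueAtInfty_zero
    by_cases hil : i = l
    · rw [hil, hwl]; exact hasValueAtInfty_zero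
    have := (hx i).mul (hδv.inv (sgn_ne_zero k))
    rw [Matrix.one_apply_ne hik, zero_mul] at this
    rw [hwi i hik hil, div_eq_mul_inv]
    exact this
  have g1 := gen_unip hpq hq hm hn h hw0 hwk hwl
  set A1 := unip v w 0 with hA1
  -- The multiple of `v` that the unipotent adds. It shifts coordinates `k` and `l` equally, so
  -- their difference stays `d`.
  set η := pair w x + (0 - pair w w / 2) * δ with hη
  have hη0 : HasValueAtInfty η 0 := by
    have e1 := hasValueAtInfty_pair (b := fun i => (1 : Matrix (Idx p q) (Idx p q) ℂ) i k) (a := 0)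
      hw0 hx
    have e2 := hasValueAtInfty_pair (a := 0) (b := 0) hw0 hw0
    have z : ∀ y, form (0 : Vec p q) y = 0 := fun y => by simp [form]
    rw [z] at e1 e2
    have e3 := e1.add ((hasValueAtInfty_zero.sub e2.half).mul hδv)
    rw [zero_div, sub_zero, zero_mul, add_zero] at e3
    exact e3
  have hpx : pair v x = δ := hpv x
  have x1k : (A1 *ᵥ x) k = x k + η := by
    rw [hA1, unip_mulVec, hpx]
    simp only [Pi.add_apply, Pi.sub_apply, Pi.smul_apply, smul_eq_mul, hwk, hv,
      constVec_twoVec_apply_left hkl]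
    rw [hη]; ring
  have x1l : (A1 *ᵥ x) l = x l + η := by
    rw [hA1, unip_mulVec, hpx]
    simp only [Pi.add_apply, Pi.sub_apply, Pi.smul_apply, smul_eq_mul, hwl, hv,
      constVec_twoVec_apply_right hkl, map_one]
    rw [hη]; ring
  have x1i : ∀ i, i ≠ k → i ≠ l → (A1 *ᵥ x) i = 0 := by
    intro i hik hil
    rw [hA1, unip_mulVec, hpx]
    simp only [Pi.add_apply, Pi.sub_apply, Pi.smul_apply, smul_eq_mul, hwi i hik hil, hv,
      constVec_twoVec_apply_of_ne hik hil]
    field_simp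
    ring
  -- The torus divides the `u`-component by `conjRat a = d`, which brings it to `1/2`, as in `e_k =
  -- (v + u) / 2`; only a multiple `t` of `v` is then in excess.
  set a := conjRat d with ha
  have ha1 : HasValueAtInfty a 1 := by simpa using hd1.conj
  have hca : conjRat a = d := conjRat_conjRat d
  have g2 := gen_hypTorus hq h ha1
  set x1 := A1 *ᵥ x with hx1
  set t := (x k + x l + 2 * η) / 2 * a - 1 / 2 with ht
  have ht0 : HasValueAtInfty t 0 := by
    have e1 := ((((hx k).add (hx l)).add ((hasValueAtInfty_C 2).mul hη0)).half.mul ha1).sub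
      hasValueAtInfty_one.half
    rw [Matrix.one_apply_eq, Matrix.one_apply_ne hkl.symm, map_ofNat] at e1
    norm_num at e1
    rw [ht]
    exact e1
  have hx2 : hypTorus k l a *ᵥ x1 = Pi.single k 1 + t • v := by
    have hC : RatFunc.C (sgn ℂ k / 2) = sgn K k / 2 := by
      rw [map_div₀, C_sgn, map_ofNat]
    rw [hypTorus, torus_mulVec, ← hv, hpv, hpu, hca, hC, x1k, x1l]
    ext i
    simp only [Pi.add_apply, Pi.smul_apply, smul_eq_mul]
    by_cases hik : i = k
    · subst hik
      rw [x1k, hv, constVec_twoVec_apply_left hkl, constVec_twoVec_apply_left hkl,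
        Pi.single_eq_same, ht]
      linear_combination ((a - 1) / 2 * (x i + x l + 2 * η) + (d⁻¹ - 1) / 2 * (x i - x l)) * hkk +
        1 / 2 * hdd
    by_cases hil : i = l
    · subst hil
      rw [x1l, hv, constVec_twoVec_apply_right hkl, constVec_twoVec_apply_right hkl,
        Pi.single_eq_of_ne hik, ht, map_neg, map_one]
      linear_combination ((a - 1) / 2 * (x k + x i + 2 * η) - (d⁻¹ - 1) / 2 * (x k - x i)) * hkk -
        1 / 2 * hdd
    · rw [x1i i hik hil, hv, constVec_twoVec_apply_of_ne hik hil,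
        constVec_twoVec_apply_of_ne hik hil, Pi.single_eq_of_ne hik]
      ring
  have hvv : pair v v = 0 := (pair_hyp h).1
  have hvk : pair v (Pi.single k 1) = sgn K k := by
    rw [hpv, Pi.single_eq_same, Pi.single_eq_of_ne hkl.symm]; ring
  have hkv : pair (Pi.single k 1) v = sgn K k := by
    rw [← conjRat_pair, hvk, conjRat_sgn]
  -- Preservation of the norm forces `t` to be skew, which is exactly what lets a central unipotent
  -- remove `t • v`.
  have htt : conjRat t = -t := by
    have e : pair (hypTorus k l a *ᵥ x1) (hypTorus k l a *ᵥ x1) = sgn K k := by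
      rw [hpair _ g2, hx1, hpair _ g1, hxx]
    rw [hx2, pair_add_left, pair_add_right, pair_add_right, pair_smul_left, pair_smul_left,
      pair_smul_right, pair_smul_right, hvv, hvk, hkv, pair_single_left, Pi.single_eq_same,
      map_one] at e
    have : sgn K k * (conjRat t + t) = 0 := by linear_combination e
    have := (mul_eq_zero.mp this).resolve_left (sgn_ne_zero k)
    linear_combination this
  have g3 := gen_unip_zero hq hm h (r := -sgn K k * t) (by rw [map_mul, map_neg, conjRat_sgn, htt]; ring)
    (by simpa using (hasValueAtInfty_sgn k).neg.mul ht0)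
  refine ⟨_, (g3.mul g2).mul g1, ?_, ?_⟩
  · rw [← Matrix.mulVec_mulVec, ← Matrix.mulVec_mulVec, ← hx1, hx2, unip_mulVec, ← hv,
      pair_add_right v, pair_smul_right v, hvv, hvk]
    ext i
    simp only [pair_zero_left, Pi.add_apply, Pi.sub_apply, Pi.smul_apply, smul_eq_mul,
      Pi.zero_apply]
    linear_combination -t * v i * hkk
  · intro i hik hil hxi
    rw [← Matrix.mulVec_mulVec, ← Matrix.mulVec_mulVec,
      unip_mulVec_single hik hil (by rw [hwi i hik hil, hxi, zero_div]),
      hypTorus_mulVec_single hik hil, unip_mulVec_single hik hil rfl]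

end

/-! ### Diagonal loops and the end of the elimination. -/

section

variable {p q : ℕ} {S : Set (Matrix (Idx p q) (Idx p q) K)} {k l : Idx p q}

/-- The diagonal matrix that scales `e_k` by `a`. -/
noncomputable def scaleSingle (k : Idx p q) (a : K) : Matrix (Idx p q) (Idx p q) K :=
  1 + ((a - 1) * sgn K k) • outer (Pi.single k 1) (Pi.single k 1)

theorem scaleSingle_mul (k : Idx p q) (a b : K) :
    scaleSingle k a * scaleSingle k b = scaleSingle k (a * b) := by
  have hk := sgn_mul_self (R := K) k
  simp only [scaleSingle, mul_add, add_mul, one_mul, mul_one, Matrix.smul_mul,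
    Matrix.mul_smul, outer_mul_outer, pair_single_left, Pi.single_eq_same, map_one]
  ext i j
  simp only [Matrix.add_apply, Matrix.smul_apply, smul_eq_mul]
  linear_combination (a - 1) * (b - 1) * sgn K k *
    outer (Pi.single k 1) (Pi.single k 1) i j * hk

theorem gen_scaleSingle_frac (hp : pLoops p q ⊆ S) (k : Idx p q) (α : ℂ) :
    Gen S (scaleSingle k (frac α ((starRingEnd ℂ) α))) := by
  set e : Vec p q := Pi.single k 1 with he
  have hk := sgn_mul_self (R := ℂ) k
  have hee : form e e = sgn ℂ k := by rw [he, form_single_left]; simp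
  have e1 : ∀ x, (sgn ℂ k • outerC e e) *ᵥ x = (sgn ℂ k * form e x) • e := fun x => by
    rw [Matrix.smul_mulVec, outerC_mulVec, smul_smul]
  have mo : ∀ x, x ∈ orth (ℂ ∙ e) ↔ form e x = 0 := fun x => by
    have := mem_orth_span_pair (v := e) (u := e) (x := x)
    rwa [sup_idem, and_self] at this
  have o : ∀ x, x - (sgn ℂ k * form e x) • e ∈ orth (ℂ ∙ e) := fun x => by
    rw [mo, sub_eq_add_neg, ← neg_smul, form_add_right, form_smul_right, hee]
    linear_combination -form e x * hk
  have e2 : ∀ x, (1 - sgn ℂ k • outerC e e) *ᵥ x = x - (sgn ℂ k * form e x) • e := fun x => by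
    rw [Matrix.sub_mulVec, e1, Matrix.one_mulVec]
  have me : ∀ t : ℂ, t • e ∈ ℂ ∙ e :=
    fun t => Submodule.smul_mem _ _ (Submodule.mem_span_singleton_self e)
  have fix : ∀ x ∈ ℂ ∙ e, (sgn ℂ k * form e x) • e = x := fun x hx => by
    obtain ⟨t, rfl⟩ := Submodule.mem_span_singleton.mp hx
    rw [form_smul_right, hee, mul_left_comm, hk, mul_one]
  obtain ⟨h, h1⟩ : ∃ h : IsCompl (ℂ ∙ e) (orth (ℂ ∙ e)), projC _ _ h = sgn ℂ k • outerC e e := by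
    refine exists_projC_eq (fun x => ?_) (fun x => ?_) (fun x hx => ?_) (fun x hx => ?_)
    · rw [e1]; exact me _
    · rw [e1]; exact o x
    · rw [e1, fix x hx]
    · rw [e1, (mo x).mp hx]; simp
  obtain ⟨h', h2⟩ : ∃ h : IsCompl (orth (ℂ ∙ e)) (ℂ ∙ e),
      projC _ _ h = 1 - sgn ℂ k • outerC e e := by
    refine exists_projC_eq (fun x => ?_) (fun x => ?_) (fun x hx => ?_) (fun x hx => ?_)
    · rw [e2]; exact o x
    · rw [e2, sub_sub_cancel]; exact me _
    · rw [e2, (mo x).mp hx]; simp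
    · rw [e2, fix x hx, sub_self]
  have he0 : e ≠ 0 := by simp [he]
  have hmem : pLoop α (ℂ ∙ e) h ∈ pLoops p q := ⟨α, _, h, finrank_span_singleton he0, rfl⟩
  have eq : pLoop α (ℂ ∙ e) h =
    frac α ((starRingEnd ℂ) α) • const (projC _ _ h) + const (projC _ _ h') := rfl
  have hg := Gen.of_mem (hp hmem) (exists_mem_loopUpq_of_mem_pLoops hmem)
  convert hg using 1
  have hc : constVec e = Pi.single k 1 := by
    ext i
    simp only [constVec, he, Pi.single_apply]
    split_ifs <;> simp
  rw [eq, h1, h2, scaleSingle, sub_eq_add_neg 1, const_add, const_neg, const_smul, const_outerC,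
    const_one, C_sgn, hc]
  ext i j
  simp only [Matrix.add_apply, Matrix.neg_apply, Matrix.smul_apply, smul_eq_mul]
  ring

theorem scaleSingle_one (k : Idx p q) : scaleSingle k (1 : K) = 1 := by
  simp [scaleSingle]

/-- Hilbert 90 for coefficient conjugation: `a` is a quotient `b / conjRat b`, and for `b = frac α
β` this quotient is a product of two scalars coming from loops of type (1). -/
theorem gen_scaleSingle (hp : pLoops p q ⊆ S) (k : Idx p q) {a : K} (ha : HasValueAtInfty a 1)
    (haa : conjRat a * a = 1) : Gen S (scaleSingle k a) := by
  have key : ∀ b : K, HasValueAtInfty b 1 → Gen S (scaleSingle k (b * (conjRat b)⁻¹)) := by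
    intro b hb
    refine hb.induction_frac (p := fun b => Gen S (scaleSingle k (b * (conjRat b)⁻¹))) ?_
      fun α β f _ hf => ?_
    · rw [map_one, inv_one, one_mul, scaleSingle_one]; exact Gen.one
    · have g1 := gen_scaleSingle_frac hp k α
      have g2 := gen_scaleSingle_frac hp k ((starRingEnd ℂ) β)
      have := (g1.mul g2).mul hf
      rw [scaleSingle_mul, scaleSingle_mul, Complex.conj_conj] at this
      convert this using 2
      have n1 := X_sub_C_ne_zero β
      have n2 := X_sub_C_ne_zero ((starRingEnd ℂ) α)
      have n3 := X_sub_C_ne_zero ((starRingEnd ℂ) β)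
      rw [map_mul, mul_inv, conjRat_frac, frac, frac, frac, frac, inv_div]
      field_simp
  -- The Hilbert 90 witness; it cannot vanish, as its value at infinity is `1`.
  have h1 : HasValueAtInfty ((1 + a) / 2) 1 := by
    have := (hasValueAtInfty_one.add ha).half
    norm_num at this
    exact this
  have := key _ h1
  have n1 := h1.ne_zero one_ne_zero
  have ha0 := ha.ne_zero one_ne_zero
  have e : (1 + a) / 2 * (conjRat ((1 + a) / 2))⁻¹ = a := by
    have hn : conjRat ((1 + a) / 2) ≠ 0 := (map_ne_zero conjRat).mpr n1
    rw [mul_inv_eq_iff_eq_mul₀ hn, map_div₀, map_add, map_one, map_ofNat]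
    linear_combination -(1 / 2 : K) * haa
  rwa [e] at this

theorem Gen.exists_mem_loopUpq (hS : ∀ A ∈ S, ∃ g ∈ loopUpq p q, (g : Matrix _ _ K) = A)
    {A : Matrix (Idx p q) (Idx p q) K} (hA : Gen S A) :
    ∃ g ∈ loopUpq p q, (g : Matrix _ _ K) = A := by
  obtain ⟨g, hg, rfl⟩ := hA
  refine ⟨g, ?_, rfl⟩
  refine (Subgroup.closure_le _).mpr (fun g hg => ?_) hg
  obtain ⟨g', hg', e⟩ := hS _ hg
  rwa [Units.ext e] at hg'

/-- The column of a loop that fixes other basis vectors vanishes at their places. -/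
theorem mulVec_single_apply_eq_zero {g : GL (Idx p q) K} (hg : g ∈ loopUpq p q) {i j : Idx p q}
    (hij : i ≠ j) (hi : g.val *ᵥ Pi.single i 1 = Pi.single i 1) :
    (g.val *ᵥ Pi.single j 1) i = 0 := by
  have := pair_mulVec_mulVec hg (Pi.single i 1) (Pi.single j 1)
  rw [hi, pair_single_left, pair_single_left, Pi.single_eq_of_ne hij, mul_zero, map_one,
    mul_one] at this
  exact (mul_eq_zero.mp this).resolve_left (sgn_ne_zero i)

theorem hasValueAtInfty_mulVec_single {g : GL (Idx p q) K} (hg : g ∈ loopUpq p q)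
    (i j : Idx p q) : HasValueAtInfty ((g.val *ᵥ Pi.single j 1) i)
      ((1 : Matrix (Idx p q) (Idx p q) ℂ) i j) := by
  rw [Matrix.mulVec_single_one]
  exact hg.1 i j

/-- The loops of the four types generate `loopUpq`. -/
theorem gen_of_mem_loopUpq (hp0 : 0 < p) (hpq : p ≤ q) (hp : pLoops p q ⊆ S) (hq : qLoops p q ⊆ S)
    (hm : mLoops p q ⊆ S) (hn : p ≠ q → nLoops p q ⊆ S)
    (hS : ∀ A ∈ S, ∃ g ∈ loopUpq p q, (g : Matrix _ _ K) = A)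
    {g : GL (Idx p q) K} (hg : g ∈ loopUpq p q) : Gen S g.val := by
  have hS' : ∀ A, Gen S A → loopAdjoint A * A = 1 := fun A hA => by
    obtain ⟨g, hg, rfl⟩ := hA.exists_mem_loopUpq hS
    exact (isUpqReal_iff g).mp hg.2
  -- Fixing one more coordinate. The partner `l` must not be fixed yet, because the moves act on it;
  -- columns in `T` survive, since the new column is orthogonal to them and so vanishes there.
  have pivot : ∀ (T : Finset (Idx p q)) (k l : Idx p q), k ∉ T → l ∉ T → sgn ℂ k = -sgn ℂ l →
      (∃ A, Gen S A ∧ ∀ i ∈ T, (A * g.val) *ᵥ Pi.single i 1 = Pi.single i 1) →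
      ∃ A, Gen S A ∧ ∀ i ∈ insert k T, (A * g.val) *ᵥ Pi.single i 1 = Pi.single i 1 := by
    rintro T k l hk hl h ⟨A, hA, hAT⟩
    obtain ⟨a, ha, rfl⟩ := hA.exists_mem_loopUpq hS
    have hag : a * g ∈ loopUpq p q := mul_mem ha hg
    have hxx : pair ((a * g).val *ᵥ Pi.single k 1) ((a * g).val *ᵥ Pi.single k 1) = sgn K k := by
      rw [pair_mulVec_mulVec hag, pair_single_left]; simp
    obtain ⟨B, hB, hBx, hBi⟩ := exists_gen_mulVec_eq_single hpq hq hm hn hS' h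
      (fun i => hasValueAtInfty_mulVec_single hag i k) hxx
    refine ⟨B * a.val, hB.mul hA, fun i hi => ?_⟩
    rw [mul_assoc, ← Matrix.mulVec_mulVec]
    rcases Finset.mem_insert.mp hi with rfl | hi
    · exact hBx
    · have hik : i ≠ k := fun e => hk (e ▸ hi)
      have hil : i ≠ l := fun e => hl (e ▸ hi)
      rw [hAT i hi]
      exact hBi i hik hil (mulVec_single_apply_eq_zero hag hik (hAT i hi))
  set k₀ : Idx p q := Sum.inl ⟨0, hp0⟩ with hk₀
  set l₀ : Idx p q := Sum.inr ⟨0, hp0.trans_le hpq⟩ with hl₀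
  have hkl : sgn ℂ l₀ = -sgn ℂ k₀ := by simp [sgn, hk₀, hl₀]
  -- One coordinate of each sign is held back as partner for all the others. Afterwards `l₀` is
  -- fixed with `k₀` as its partner, and only `k₀` is left.
  have stage : ∀ T : Finset (Idx p q), k₀ ∉ T → l₀ ∉ T →
      ∃ A, Gen S A ∧ ∀ i ∈ T, (A * g.val) *ᵥ Pi.single i 1 = Pi.single i 1 := by
    intro T
    induction T using Finset.induction_on with
    | empty => exact fun _ _ => ⟨1, Gen.one, by simp⟩
    | insert i T hi ih =>
      intro h1 h2
      have h1' : k₀ ∉ T := fun e => h1 (Finset.mem_insert_of_mem e)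
      have h2' : l₀ ∉ T := fun e => h2 (Finset.mem_insert_of_mem e)
      rcases i with i | i
      · exact pivot T _ l₀ hi h2' (by simp [sgn, hl₀]) (ih h1' h2')
      · exact pivot T _ k₀ hi h1' (by simp [sgn, hk₀]) (ih h1' h2')
  obtain ⟨A, hA, hAT⟩ := pivot ((Finset.univ.erase k₀).erase l₀) l₀ k₀ (by simp) (by simp) hkl
    (stage _ (by simp) (by simp))
  have hfix : ∀ i, i ≠ k₀ → (A * g.val) *ᵥ Pi.single i 1 = Pi.single i 1 := fun i hi =>
    hAT i (by by_cases h : i = l₀ <;> simp [h, hi])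
  obtain ⟨a, ha, rfl⟩ := hA.exists_mem_loopUpq hS
  have hag : a * g ∈ loopUpq p q := mul_mem ha hg
  set c : K := ((a * g).val *ᵥ Pi.single k₀ 1) k₀ with hc
  have hcol : (a * g).val *ᵥ Pi.single k₀ 1 = Pi.single k₀ c := by
    ext i
    by_cases hi : i = k₀
    · rw [hi, Pi.single_eq_same]
    · rw [Pi.single_eq_of_ne hi]
      exact mulVec_single_apply_eq_zero hag hi (hfix i hi)
  have hc1 : HasValueAtInfty c 1 := by
    have := hasValueAtInfty_mulVec_single hag k₀ k₀
    rwa [Matrix.one_apply_eq] at this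
  have hcc : conjRat c * c = 1 := by
    have := pair_mulVec_mulVec hag (Pi.single k₀ 1) (Pi.single k₀ 1)
    rw [hcol, pair_single_left, pair_single_left, Pi.single_eq_same, Pi.single_eq_same, map_one,
      mul_assoc] at this
    simpa using mul_left_cancel₀ (sgn_ne_zero k₀) (this.trans (mul_assoc _ _ _))
  have hs : (a * g).val = scaleSingle k₀ c := by
    apply Matrix.ext_of_mulVec_single
    intro i
    have : scaleSingle k₀ c *ᵥ Pi.single i 1 =
        Pi.single i 1 + ((c - 1) * sgn K k₀ * pair (Pi.single k₀ 1) (Pi.single i 1)) •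
          Pi.single k₀ 1 := by
      rw [scaleSingle, Matrix.add_mulVec, Matrix.one_mulVec, Matrix.smul_mulVec, outer_mulVec,
        smul_smul]
    rw [this, pair_single_left]
    by_cases hi : i = k₀
    · rw [hi, hcol, Pi.single_eq_same, map_one, ← Pi.single_smul, ← Pi.single_add]
      congr 1
      have := sgn_mul_self (R := K) k₀
      rw [smul_eq_mul]
      linear_combination (1 - c) * this
    · rw [Pi.single_eq_of_ne (Ne.symm hi), mul_zero, mul_zero, zero_smul, add_zero]
      exact hfix i hi
  have hinv : Gen S (a⁻¹).val := hA.of_mul_eq_one a.mul_inv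
  have hgen := hinv.mul (gen_scaleSingle hp k₀ hc1 hcc)
  rw [← hs, ← Units.val_mul, inv_mul_cancel_left] at hgen
  exact hgen

theorem isGeneratedBy_loopUpq (hp0 : 0 < p) (hpq : p ≤ q) (hp : pLoops p q ⊆ S)
    (hq : qLoops p q ⊆ S) (hm : mLoops p q ⊆ S) (hn : p ≠ q → nLoops p q ⊆ S)
    (hS : S ⊆ pLoops p q ∪ qLoops p q ∪ mLoops p q ∪ nLoops p q) :
    IsGeneratedBy (loopUpq p q) S := by
  have hS' : ∀ A ∈ S, ∃ g ∈ loopUpq p q, (g : Matrix _ _ K) = A := by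
    intro A hA
    rcases hS hA with ((h | h) | h) | h
    · exact exists_mem_loopUpq_of_mem_pLoops h
    · exact exists_mem_loopUpq_of_mem_qLoops h
    · exact exists_mem_loopUpq_of_mem_mLoops h
    · exact exists_mem_loopUpq_of_mem_nLoops h
  refine ⟨hS', le_antisymm ?_ fun g hg => ?_⟩
  · rw [Subgroup.closure_le]
    intro g hg
    obtain ⟨g', hg', e⟩ := hS' _ hg
    rwa [Units.ext e] at hg'
  · obtain ⟨g', hg', e⟩ := gen_of_mem_loopUpq hp0 hpq hp hq hm hn hS' hg
    rwa [Units.ext e] at hg'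

end

end RationalLoop


theorem mainTheorem4 (p q : ℕ) (hp : 0 < p) (hpq : p ≤ q) :
    (p = q → RationalLoop.IsGeneratedBy (RationalLoop.loopUpq p q)
      (RationalLoop.pLoops p q ∪ RationalLoop.qLoops p q ∪ RationalLoop.mLoops p q)) ∧
    (p ≠ q → RationalLoop.IsGeneratedBy (RationalLoop.loopUpq p q)
      (RationalLoop.pLoops p q ∪ RationalLoop.qLoops p q ∪ RationalLoop.mLoops p q ∪
        RationalLoop.nLoops p q)) := by
  constructor
  · intro h
    exact RationalLoop.isGeneratedBy_loopUpq hp hpq (fun A hA => Or.inl (Or.inl hA))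
      (fun A hA => Or.inl (Or.inr hA)) (fun A hA => Or.inr hA) (fun h' => absurd h h')
      Set.subset_union_left
  · intro _
    exact RationalLoop.isGeneratedBy_loopUpq hp hpq (fun A hA => Or.inl (Or.inl (Or.inl hA)))
      (fun A hA => Or.inl (Or.inl (Or.inr hA))) (fun A hA => Or.inl (Or.inr hA))
      (fun _ A hA => Or.inr hA) le_rfl
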